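/- Let INF be the first-order theory with the axioms of Quine's New Foundations (extensionality, and comprehension for stratified formulas) in the language with $\in$ and $=$, over intuitionistic logic. Ordered pairs are Kuratowski pairs; $\mathrm{FUNC}$ is the set of all $f$ such that $\langle x,y\rangle,\langle x,z\rangle\in f$ implies $y=z$. A set is finite if it belongs to every $F$ that contains the empty set and contains $u\cup\{c\}$ whenever $u\in F$ and $c\notin u$. The Church number zero is $\mathbf 0=\{\langle f,\mathrm{id}\rangle : f=f\}$ with $\mathrm{id}=\{\langle x,x\rangle : x=x\}$. Church successor $\mathsf S$ is the function with domain $\mathrm{FUNC}$ given by $$\mathsf S z=\{\langle f,p\rangle : f\in\mathrm{FUNC},\ p=\{\langle x,w\rangle : \exists t\,\exists q\,(t\in\mathrm{FUNC}\wedge\langle f,t\rangle\in z\wedge\langle x,q\rangle\in t\wedge\langle q,w\rangle\in f)\}\}.$$ The set $\mathbb N$ of Church numbers is the intersection of all sets that contain $\mathbf 0$ and are closed under $\mathsf S$. The graph of addition, $\{\langle x,n,y\rangle : x\oplus n=y\}$, is the intersection of all $X$ with $\langle x,\mathbf 0,x\rangle\in X$ for $x\in\mathbb N$ and with $\langle x,\mathsf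 S n,\mathsf S y\rangle\in X$ whenever $x,n,y\in\mathbb N$ and $\langle x,n,y\rangle\in X$; and $x<y$ means that $x\oplus\mathsf S n=y$ for some $n\in\mathbb N$. A double successor is a $p$ with $p=\mathsf S a=\mathsf S b$ for some $a\ne b$ in $\mathbb N$. $\mathsf{STEM}$ is the intersection of $\mathbb N$ and all sets $X$ such that $\mathbf 0\in X$ and such that $\mathsf S u\in X$ whenever $u\in\mathbb N\cap X$ and $\forall v\in\mathbb N\,(\mathsf S v=\mathsf S u\to v=u)$. For $n\in\mathbb N$ the loop $\mathcal L(n)$ is the intersection of all sets that contain $n$ and are closed under $\mathsf S$. **Theorem.** The following is provable in INF. The sets $\mathbb N$, $\mathsf{STEM}$ and the graph of $\oplus$ exist. Suppose $\mathbb N$ is finite, and $\mathsf S k=\mathsf S n$ with $k\in\mathsf{STEM}$, $n\in\mathbb N$ and $k\neq n$. Then: 1. there is exactly one double successor, namely $\mathsf S k$; 2. if $j,\ell\in\mathbb N$, $j\ne\ell$, $j<\ell$ and $\mathsf S j=\mathsf S\ell$, then $j=k$ and $\ell=n$; 3. if $j,\ell\in\mathbb N$, $j\ne\ell$ and $\mathsf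 S j=\mathsf S\ell$, then $\{j,\ell\}=\{k,n\}$, that is, $j=k$ and $\ell=n$, or $j=n$ and $\ell=k$; 4. $\mathcal L(n)$ exists, $\mathbb N$ is the disjoint union of $\mathsf{STEM}$ and $\mathcal L(n)$, and $\mathsf S$ maps $\mathcal L(n)$ bijectively onto itself. -/

import Mathlib

/-! # Intuitionistic New Foundations (INF) and the Church numbers

First-order intuitionistic logic in the language with `∈` and `=`, the theory INF (extensionality
and stratified comprehension), and the set-theoretic notions about Church numbers, each given as a
formula of that language.

Variables are de Bruijn indices: in the scope of a quantifier the bound variable is `0`, and an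
outer variable `x` is written `x + 1`. -/

namespace INF

/-- Formulas of set theory. The only terms are variables. -/
inductive Fml : Type
  | mem : ℕ → ℕ → Fml
  | eq : ℕ → ℕ → Fml
  | bot : Fml
  | and : Fml → Fml → Fml
  | or : Fml → Fml → Fml
  | imp : Fml → Fml → Fml
  | all : Fml → Fml
  | ex : Fml → Fml

namespace Fml

/-- Negation `φ → ⊥`. -/
def neg (φ : Fml) : Fml := imp φ bot

/-- Biconditional `(φ → ψ) ∧ (ψ → φ)`. -/
def iff (φ ψ : Fml) : Fml := and (imp φ ψ) (imp ψ φ)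

/-- Extension of a renaming to the scope of a quantifier. -/
def lift (f : ℕ → ℕ) : ℕ → ℕ
  | 0 => 0
  | k + 1 => f k + 1

/-- Capture-avoiding substitution of variables for the free variables. -/
def rename : (ℕ → ℕ) → Fml → Fml
  | f, mem x y => mem (f x) (f y)
  | f, eq x y => eq (f x) (f y)
  | _, bot => bot
  | f, and φ ψ => and (rename f φ) (rename f ψ)
  | f, or φ ψ => or (rename f φ) (rename f ψ)
  | f, imp φ ψ => imp (rename f φ) (rename f ψ)
  | f, all φ => all (rename (lift f) φ)
  | f, ex φ => ex (rename (lift f) φ)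

/-- Weakening: `φ` seen from the scope of one more quantifier. -/
def shift (φ : Fml) : Fml := rename Nat.succ φ

/-- The renaming that sends `0` to `t` and every other variable `k + 1` to `k`. -/
def instMap (t : ℕ) : ℕ → ℕ
  | 0 => t
  | k + 1 => k

/-- `φ[t/0]`: instantiate the variable `0`, as bound by a quantifier in front of `φ`. -/
def inst (φ : Fml) (t : ℕ) : Fml := rename (instMap t) φ

/-- Extension of an index assignment by the index `t` of a newly bound variable. -/
def cons (t : ℕ) (σ : ℕ → ℕ) : ℕ → ℕ
  | 0 => t
  | k + 1 => σ k

/-- `φ` is stratified by an assignment of natural numbers to its variables that extends the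
assignment `σ` to the free ones: in every subformula `x ∈ y` the index of `y` is one more than that
of `x`, and in every subformula `x = y` the indices agree. -/
def StratifiedBy : (ℕ → ℕ) → Fml → Prop
  | σ, mem x y => σ y = σ x + 1
  | σ, eq x y => σ x = σ y
  | _, bot => True
  | σ, and φ ψ => StratifiedBy σ φ ∧ StratifiedBy σ ψ
  | σ, or φ ψ => StratifiedBy σ φ ∧ StratifiedBy σ ψ
  | σ, imp φ ψ => StratifiedBy σ φ ∧ StratifiedBy σ ψ
  | σ, all φ => ∃ t, StratifiedBy (cons t σ) φ
  | σ, ex φ => ∃ t, StratifiedBy (cons t σ) φ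

/-- `φ` is stratified. -/
def Stratified (φ : Fml) : Prop := ∃ σ : ℕ → ℕ, StratifiedBy σ φ

end Fml

end INF

infix:62 " ∊ " => INF.Fml.mem
infix:62 " ≐ " => INF.Fml.eq
infixr:58 " ⋏ " => INF.Fml.and
infixr:57 " ⋎ " => INF.Fml.or
infixr:55 " ⟹ " => INF.Fml.imp
infix:54 " ⟺ " => INF.Fml.iff
prefix:60 "∼" => INF.Fml.neg

namespace INF

open Fml

/-- Intuitionistic natural deduction with equality: `Derives T Γ φ` says that `φ` follows from the
axioms `T` and the open assumptions `Γ`. Free variables of an axiom are read universally; those of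
an assumption are fixed parameters. -/
inductive Derives (T : Set Fml) : List Fml → Fml → Prop
  | ax {Γ φ} : φ ∈ T → Derives T Γ φ
  | hyp {Γ φ} : φ ∈ Γ → Derives T Γ φ
  | botE {Γ φ} : Derives T Γ bot → Derives T Γ φ
  | andI {Γ φ ψ} : Derives T Γ φ → Derives T Γ ψ → Derives T Γ (φ ⋏ ψ)
  | andL {Γ φ ψ} : Derives T Γ (φ ⋏ ψ) → Derives T Γ φ
  | andR {Γ φ ψ} : Derives T Γ (φ ⋏ ψ) → Derives T Γ ψ
  | orL {Γ φ ψ} : Derives T Γ φ → Derives T Γ (φ ⋎ ψ)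
  | orR {Γ φ ψ} : Derives T Γ ψ → Derives T Γ (φ ⋎ ψ)
  | orE {Γ φ ψ χ} : Derives T Γ (φ ⋎ ψ) → Derives T (φ :: Γ) χ → Derives T (ψ :: Γ) χ →
      Derives T Γ χ
  | impI {Γ φ ψ} : Derives T (φ :: Γ) ψ → Derives T Γ (φ ⟹ ψ)
  | impE {Γ φ ψ} : Derives T Γ (φ ⟹ ψ) → Derives T Γ φ → Derives T Γ ψ
  | allI {Γ φ} : Derives T (Γ.map shift) φ → Derives T Γ (all φ)
  | allE {Γ φ} (t : ℕ) : Derives T Γ (all φ) → Derives T Γ (φ.inst t)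
  | exI {Γ φ} (t : ℕ) : Derives T Γ (φ.inst t) → Derives T Γ (ex φ)
  | exE {Γ φ χ} : Derives T Γ (ex φ) → Derives T (φ :: Γ.map shift) χ.shift → Derives T Γ χ
  | eqRefl {Γ} (t : ℕ) : Derives T Γ (t ≐ t)
  | eqSubst {Γ} (φ : Fml) {s t : ℕ} : Derives T Γ (s ≐ t) → Derives T Γ (φ.inst s) →
      Derives T Γ (φ.inst t)

/-- Extensionality: sets with the same elements are equal. -/
def extensionality : Fml :=
  all (all (all (0 ∊ 2 ⟺ 0 ∊ 1) ⟹ 1 ≐ 0))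

/-- Comprehension for `φ(x, params)`, where `x` is the variable `0` of `φ` and the parameters are the
other free variables of `φ`: `∃ y, ∀ x, x ∈ y ↔ φ(x, params)`, with `y` not free in `φ`. -/
def comprehension (φ : Fml) : Fml :=
  ex (all (0 ∊ 1 ⟺ rename (lift Nat.succ) φ))

/-- Intuitionistic NF: extensionality and comprehension for stratified formulas. -/
def theory : Set Fml :=
  {φ | φ = extensionality ∨ ∃ ψ : Fml, Stratified ψ ∧ φ = comprehension ψ}

/-- INF proves `φ`. -/
def Proves (φ : Fml) : Prop := Derives theory [] φ

/-! ### Pairs, functions, finite sets -/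

/-- `s = {x}`. -/
def isSingleton (s x : ℕ) : Fml := all (0 ∊ (s + 1) ⟺ 0 ≐ (x + 1))

/-- `s = {x, y}`. -/
def isUPair (s x y : ℕ) : Fml := all (0 ∊ (s + 1) ⟺ 0 ≐ (x + 1) ⋎ 0 ≐ (y + 1))

/-- `p = ⟨x, y⟩ = {{x}, {x, y}}`. -/
def isPair (p x y : ℕ) : Fml :=
  all (0 ∊ (p + 1) ⟺ isSingleton 0 (x + 1) ⋎ isUPair 0 (x + 1) (y + 1))

/-- `⟨x, y⟩ ∈ f`. -/
def pairIn (x y f : ℕ) : Fml := ex (isPair 0 (x + 1) (y + 1) ⋏ 0 ∊ (f + 1))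

/-- `t = ⟨x, y, z⟩ = ⟨⟨x, y⟩, {{z}}⟩`; the bound variables are `a = ⟨x, y⟩` (index `2`), `b = {z}`
(index `1`) and `c = {b}` (index `0`). -/
def isTriple (t x y z : ℕ) : Fml :=
  ex (ex (ex (isPair 2 (x + 3) (y + 3) ⋏ isSingleton 1 (z + 3) ⋏ isSingleton 0 1 ⋏
    isPair (t + 3) 2 0)))

/-- `⟨x, y, z⟩ ∈ A`. -/
def tripleIn (x y z A : ℕ) : Fml :=
  ex (isTriple 0 (x + 1) (y + 1) (z + 1) ⋏ 0 ∊ (A + 1))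

/-- `f ∈ FUNC`: for all `x, y, z`, if `⟨x, y⟩ ∈ f` and `⟨x, z⟩ ∈ f` then `y = z`. -/
def isFunc (f : ℕ) : Fml :=
  all (all (all (pairIn 2 1 (f + 3) ⟹ pairIn 2 0 (f + 3) ⟹ 1 ≐ 0)))

/-- `Λ ∈ F`, where `Λ` is the empty set. -/
def emptyIn (F : ℕ) : Fml := ex (all (∼(0 ∊ 1)) ⋏ 0 ∊ (F + 1))

/-- `u ∪ {c} ∈ F`. -/
def adjoinIn (u c F : ℕ) : Fml :=
  all (all (0 ∊ 1 ⟺ 0 ∊ (u + 2) ⋎ 0 ≐ (c + 2)) ⟹ 0 ∊ (F + 1))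

/-- `X ∈ FINITE`: `X` belongs to every `F` that contains the empty set and, with each `u`, also all
`u ∪ {c}` with `c ∉ u`. -/
def isFinite (X : ℕ) : Fml :=
  all (emptyIn 0 ⟹ all (all (1 ∊ 2 ⟹ ∼(0 ∊ 1) ⟹ adjoinIn 1 0 2)) ⟹ (X + 1) ∊ 0)

/-! ### Church numbers -/

/-- `p` is the set of the pairs `⟨x, w⟩` such that for some `t ∈ FUNC` and some `q`,
`⟨f, t⟩ ∈ z`, `⟨x, q⟩ ∈ t` and `⟨q, w⟩ ∈ f`; so `p x = f (z f x)`.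
Bound variables: `u = 4`, `x = 3`, `w = 2`, `t = 1`, `q = 0`. -/
def isIterSucc (p f z : ℕ) : Fml :=
  all (0 ∊ (p + 1) ⟺ ex (ex (ex (ex (isPair 4 3 2 ⋏ isFunc 1 ⋏ pairIn (f + 5) 1 (z + 5) ⋏
    pairIn 3 0 1 ⋏ pairIn 0 2 (f + 5))))))

/-- `⟨z, v⟩ ∈ S`, that is `v = S z`, for the Church successor function `S`, whose domain is `FUNC`:
`z ∈ FUNC` and `v` is the set of the pairs `⟨f, p⟩` with `f ∈ FUNC` and `p` as in `isIterSucc`. -/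
def isSucc (v z : ℕ) : Fml :=
  isFunc z ⋏ all (0 ∊ (v + 1) ⟺ ex (ex (isPair 2 1 0 ⋏ isFunc 1 ⋏ isIterSucc 0 1 (z + 3))))

/-- `i` is the identity function `{⟨x, x⟩ : x = x}`. -/
def isId (i : ℕ) : Fml := all (0 ∊ (i + 1) ⟺ ex (isPair 1 0 0))

/-- `o` is the Church number zero, `{⟨f, id⟩ : f = f}`. -/
def isZero (o : ℕ) : Fml := all (0 ∊ (o + 1) ⟺ ex (ex (isId 0 ⋏ isPair 2 1 0)))

/-- `0 ∈ X` for the Church number zero. -/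
def zeroIn (X : ℕ) : Fml := ex (isZero 0 ⋏ 0 ∊ (X + 1))

/-- `S u ∈ X`. -/
def succIn (u X : ℕ) : Fml := all (isSucc 0 (u + 1) ⟹ 0 ∊ (X + 1))

/-- `S a = S b`. -/
def sameSucc (a b : ℕ) : Fml := ex (isSucc 0 (a + 1) ⋏ isSucc 0 (b + 1))

/-- `X` is closed under Church successor. -/
def succClosed (X : ℕ) : Fml := all (0 ∊ (X + 1) ⟹ succIn 0 (X + 1))

/-- `N` is the set of Church numbers, the intersection of all sets that contain zero and are closed
under Church successor. -/
def isChurchNumbers (N : ℕ) : Fml :=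
  all (0 ∊ (N + 1) ⟺ all (zeroIn 0 ⟹ succClosed 0 ⟹ 1 ∊ 0))

/-- `Sum` is the intersection of all `X` such that `⟨x, 0, x⟩ ∈ X` for `x ∈ N`, and such that
`⟨x, n, y⟩ ∈ X` implies `⟨x, S n, S y⟩ ∈ X` for `x, n, y ∈ N`.
Bound variables in the second condition: `X = 3`, `x = 2`, `n = 1`, `y = 0`, and then two more for
`S n` and `S y`. -/
def isSum (Sum N : ℕ) : Fml :=
  all (0 ∊ (Sum + 1) ⟺ all (
    all (0 ∊ (N + 3) ⟹ ex (isZero 0 ⋏ tripleIn 1 0 1 2)) ⟹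
    all (all (all (2 ∊ (N + 5) ⟹ 1 ∊ (N + 5) ⟹ 0 ∊ (N + 5) ⟹ tripleIn 2 1 0 3 ⟹
      all (all (isSucc 1 3 ⟹ isSucc 0 2 ⟹ tripleIn 4 1 0 5))))) ⟹
    1 ∊ 0))

/-- `x < y`: for some `n ∈ N`, `x ⊕ S n = y`, where `x ⊕ m = y` means `⟨x, m, y⟩ ∈ Sum`. -/
def less (x y N Sum : ℕ) : Fml :=
  ex (0 ∊ (N + 1) ⋏ ex (isSucc 0 1 ⋏ tripleIn (x + 2) 0 (y + 2) (Sum + 2)))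

/-! ### Stem, loop and double successors -/

/-- `p` is a double successor: `S a = S b = p` for some `a ≠ b` in `N`. -/
def isDoubleSucc (p N : ℕ) : Fml :=
  ex (ex (1 ∊ (N + 2) ⋏ 0 ∊ (N + 2) ⋏ ∼(1 ≐ 0) ⋏ isSucc (p + 2) 1 ⋏ isSucc (p + 2) 0))

/-- `S u` is not a double successor: `v = u` for all `v ∈ N` with `S v = S u`. -/
def succNotDouble (u N : ℕ) : Fml :=
  all (0 ∊ (N + 1) ⟹ sameSucc 0 (u + 1) ⟹ 0 ≐ (u + 1))

/-- `T` is the stem: the intersection of `N` and all sets `X` that contain zero and are closed under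
the successors (of members of `N`) that are not double successors. -/
def isStem (T N : ℕ) : Fml :=
  all (0 ∊ (T + 1) ⟺ 0 ∊ (N + 1) ⋏ all (zeroIn 0 ⟹
    all (0 ∊ (N + 3) ⟹ 0 ∊ 1 ⟹ succNotDouble 0 (N + 3) ⟹ succIn 0 1) ⟹ 1 ∊ 0))

/-- `L` is the loop at `n`: the intersection of all sets that contain `n` and are closed under Church
successor. -/
def isLoop (L n : ℕ) : Fml :=
  all (0 ∊ (L + 1) ⟺ all ((n + 2) ∊ 0 ⟹ succClosed 0 ⟹ 1 ∊ 0))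

/-- Church successor is a bijection from `L` to `L`: it maps `L` to `L`, is onto `L`, and is
one-to-one on `L`. -/
def succBijectiveOn (L : ℕ) : Fml :=
  all (0 ∊ (L + 1) ⟹ ex (0 ∊ (L + 2) ⋏ isSucc 0 1)) ⋏
  all (0 ∊ (L + 1) ⟹ ex (0 ∊ (L + 2) ⋏ isSucc 1 0)) ⋏
  all (all (1 ∊ (L + 2) ⟹ 0 ∊ (L + 2) ⟹ sameSucc 1 0 ⟹ 1 ≐ 0))

/-- There is exactly one double successor, and it is `S k`. -/
def uniqueDoubleSucc (k N : ℕ) : Fml :=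
  ex (isSucc 0 (k + 1) ⋏ all (isDoubleSucc 0 (N + 2) ⟺ 0 ≐ 1))

/-- For all `j, l ∈ N` with `j ≠ l`, `j < l` and `S j = S l`, one has `j = k` and `l = n`. -/
def onlyOrderedPair (k n N Sum : ℕ) : Fml :=
  all (all (1 ∊ (N + 2) ⟹ 0 ∊ (N + 2) ⟹ ∼(1 ≐ 0) ⟹ less 1 0 (N + 2) (Sum + 2) ⟹
    sameSucc 1 0 ⟹ 1 ≐ (k + 2) ⋏ 0 ≐ (n + 2)))

/-- For all `j, l ∈ N` with `j ≠ l` and `S j = S l`, one has `j = k` and `l = n`, or `j = n` and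
`l = k`. -/
def onlyPair (k n N : ℕ) : Fml :=
  all (all (1 ∊ (N + 2) ⟹ 0 ∊ (N + 2) ⟹ ∼(1 ≐ 0) ⟹ sameSucc 1 0 ⟹
    (1 ≐ (k + 2) ⋏ 0 ≐ (n + 2)) ⋎ (1 ≐ (n + 2) ⋏ 0 ≐ (k + 2))))

/-- `N` is the disjoint union of `T` and `L`. -/
def isDisjointUnion (N T L : ℕ) : Fml :=
  all (0 ∊ (N + 1) ⟺ 0 ∊ (T + 1) ⋎ 0 ∊ (L + 1)) ⋏ all (∼(0 ∊ (T + 1) ⋏ 0 ∊ (L + 1)))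

end INF

/-! The claim is about derivability, but it is proved semantically. By completeness
(`derives_of_forces`) it is enough that the sentence is forced at every world of every Kripke model
of INF. There, reasoning about forcing replaces formal derivations, although each induction must
still be over a stratified formula, since only those define sets. Completeness comes from the model
whose worlds are prime theories with witnesses. All theories share one countable stock of variables,
so the morphisms are renamings instead of inclusions: doubling every variable frees the odd ones for
witnesses.

Inside a model, `Reach u v` plays the part of `≤`. It is total on Church numbers (`reach_total`)
even without decidable equality. A successor that lies in the stem has only one predecessor, so one
can walk backwards from a stem number. Hence the stem is closed under predecessors
(`mem_stem_of_reach`), and for `x` in the stem `S x` never reaches `x`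
(`not_reach_succ_of_mem_stem`), since otherwise the walk would end with zero being a successor.

Now let `S k = S n` with `k` in the stem and `k ≠ n`. Every number reaches `k` or is reached from
`n` (`reach_or_reach`). The former lie in the stem and the latter do not. Moreover `k` reaches `n`,
so `S n = S k` returns to `n` (`reach_succ_self`), and the numbers reached from `n` form a cycle.

What remains is injectivity of successor on the cycle (`eq_of_succ_eq_of_loop`). Nothing is counted:
finiteness is used only to make equality of Church numbers decidable (`decEq_of_isFinite`). If `S a
= S b` with `a ≠ b` on the cycle, start at this common value and go round: at every point, `b` can
be reached without a step from `a`, and `a` without a step from `b`. On arrival at `a` this is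
absurd. So in any collision `j ≠ l` one member reaches `k`; that member is `k` itself, and the other
is `n` (`eq_pair_of_succ_eq`). -/

namespace INF

open Fml

/-! ### Renaming and free variables -/

namespace Fml

/-- `x` occurs free in the formula. -/
def Occ : ℕ → Fml → Prop
  | x, mem y z => x = y ∨ x = z
  | x, eq y z => x = y ∨ x = z
  | _, bot => False
  | x, and φ ψ => Occ x φ ∨ Occ x ψ
  | x, or φ ψ => Occ x φ ∨ Occ x ψ
  | x, imp φ ψ => Occ x φ ∨ Occ x ψ
  | x, all φ => Occ (x + 1) φ
  | x, ex φ => Occ (x + 1) φ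

theorem rename_congr {φ : Fml} : ∀ {f g : ℕ → ℕ}, (∀ x, Occ x φ → f x = g x) →
    rename f φ = rename g φ := by
  have key : ∀ {φ : Fml} {f g : ℕ → ℕ}, (∀ x, Occ (x + 1) φ → f x = g x) →
      ∀ x, Occ x φ → lift f x = lift g x := by
    intro φ f g h x hx
    cases x with
    | zero => rfl
    | succ k => simp [lift, h k hx]
  induction φ with
  | mem x y => intro f g h; simp [rename, h x (Or.inl rfl), h y (Or.inr rfl)]
  | eq x y => intro f g h; simp [rename, h x (Or.inl rfl), h y (Or.inr rfl)]
  | bot => intros; rfl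
  | and φ ψ h1 h2 | or φ ψ h1 h2 | imp φ ψ h1 h2 =>
    intro f g h
    simp [rename, h1 (fun x hx => h x (Or.inl hx)), h2 (fun x hx => h x (Or.inr hx))]
  | all φ h1 | ex φ h1 =>
    intro f g h
    simp only [rename]
    rw [h1 (key h)]

theorem lift_comp (f g : ℕ → ℕ) : lift f ∘ lift g = lift (f ∘ g) := by
  funext x; cases x <;> rfl

theorem rename_rename (φ : Fml) : ∀ f g : ℕ → ℕ, rename f (rename g φ) = rename (f ∘ g) φ := by
  induction φ with
  | mem x y | eq x y => intros; rfl
  | bot => intros; rfl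
  | and φ ψ h1 h2 | or φ ψ h1 h2 | imp φ ψ h1 h2 => intro f g; simp [rename, h1, h2]
  | all φ h1 | ex φ h1 => intro f g; simp [rename, h1, lift_comp]

theorem lift_id : lift id = id := by
  funext x; cases x <;> rfl

theorem rename_id (φ : Fml) : rename id φ = φ := by
  induction φ with
  | mem x y | eq x y => rfl
  | bot => rfl
  | and φ ψ h1 h2 | or φ ψ h1 h2 | imp φ ψ h1 h2 => simp [rename, h1, h2]
  | all φ h1 | ex φ h1 => simp [rename, h1, lift_id]

theorem rename_eq_self {φ : Fml} {f : ℕ → ℕ} (h : ∀ x, Occ x φ → f x = x) : rename f φ = φ := by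
  rw [rename_congr (g := id) h, rename_id]

theorem rename_shift (f : ℕ → ℕ) (φ : Fml) : rename (lift f) φ.shift = (rename f φ).shift := by
  simp only [shift, rename_rename]; rfl

theorem rename_inst (f : ℕ → ℕ) (φ : Fml) (t : ℕ) :
    rename f (φ.inst t) = (rename (lift f) φ).inst (f t) := by
  simp only [inst, rename_rename]
  congr 1
  funext x; cases x <;> rfl

theorem lift_injective {f : ℕ → ℕ} (hf : f.Injective) : (lift f).Injective := by
  intro a b h
  cases a <;> cases b <;> simp [lift] at h ⊢
  exact hf h

theorem exists_occ_bound (φ : Fml) : ∃ n, ∀ x, Occ x φ → x < n := by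
  induction φ with
  | mem x y | eq x y => exact ⟨x + y + 1, fun z hz => by rcases hz with rfl | rfl <;> omega⟩
  | bot => exact ⟨0, fun _ h => h.elim⟩
  | and φ ψ h1 h2 | or φ ψ h1 h2 | imp φ ψ h1 h2 =>
    obtain ⟨n, hn⟩ := h1
    obtain ⟨m, hm⟩ := h2
    refine ⟨n + m, fun z hz => ?_⟩
    rcases hz with h | h
    · have := hn z h; omega
    · have := hm z h; omega
  | all φ h1 | ex φ h1 =>
    obtain ⟨n, hn⟩ := h1
    exact ⟨n, fun z hz => by have := hn _ hz; omega⟩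

theorem exists_occ_bound_list (l : List Fml) : ∃ n, ∀ φ ∈ l, ∀ x, Occ x φ → x < n := by
  induction l with
  | nil => exact ⟨0, by simp⟩
  | cons φ l ih =>
    obtain ⟨n, hn⟩ := ih
    obtain ⟨m, hm⟩ := exists_occ_bound φ
    refine ⟨n + m, fun ψ hψ x hx => ?_⟩
    rcases List.mem_cons.1 hψ with rfl | h
    · have := hm x hx; omega
    · have := hn ψ h x hx; omega

theorem Occ.of_rename {φ : Fml} : ∀ {f : ℕ → ℕ} {y : ℕ}, Occ y (rename f φ) →
    ∃ x, Occ x φ ∧ f x = y := by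
  have key : ∀ {φ : Fml} {f : ℕ → ℕ} {y : ℕ}, (∃ x, Occ x φ ∧ lift f x = y + 1) →
      ∃ x, Occ (x + 1) φ ∧ f x = y := by
    rintro φ f y ⟨x, hx, h⟩
    cases x with
    | zero => simp [lift] at h
    | succ k => exact ⟨k, hx, by simpa [lift] using h⟩
  induction φ with
  | mem a b | eq a b =>
    intro f y h
    rcases h with h | h
    · exact ⟨a, Or.inl rfl, h.symm⟩
    · exact ⟨b, Or.inr rfl, h.symm⟩
  | bot => intro f y h; exact h.elim
  | and φ ψ h1 h2 | or φ ψ h1 h2 | imp φ ψ h1 h2 =>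
    intro f y h
    rcases h with h | h
    · obtain ⟨x, hx, e⟩ := h1 h; exact ⟨x, Or.inl hx, e⟩
    · obtain ⟨x, hx, e⟩ := h2 h; exact ⟨x, Or.inr hx, e⟩
  | all φ h1 | ex φ h1 => intro f y h; exact key (h1 h)

theorem stratifiedBy_rename (φ : Fml) : ∀ (f σ : ℕ → ℕ),
    StratifiedBy σ (rename f φ) ↔ StratifiedBy (σ ∘ f) φ := by
  have key : ∀ (f σ : ℕ → ℕ) (t : ℕ), cons t σ ∘ lift f = cons t (σ ∘ f) := by
    intro f σ t; funext x; cases x <;> rfl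
  induction φ with
  | mem x y | eq x y => intros; rfl
  | bot => intros; rfl
  | and φ ψ h1 h2 | or φ ψ h1 h2 | imp φ ψ h1 h2 => intro f σ; simp [rename, StratifiedBy, h1, h2]
  | all φ h1 | ex φ h1 => intro f σ; simp [rename, StratifiedBy, h1, key]

/-- Injectivity matters: identifying variables can turn `x ∈ y` into the unstratified `x ∈ x`.
Indices off the range of `f` are irrelevant, hence the default `0`. -/
theorem Stratified.rename {φ : Fml} (h : Stratified φ) {f : ℕ → ℕ} (hf : f.Injective) :
    Stratified (rename f φ) := by
  obtain ⟨σ, hσ⟩ := h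
  refine ⟨Function.extend f σ 0, ?_⟩
  rw [stratifiedBy_rename]
  convert hσ using 1
  funext x
  exact hf.extend_apply σ 0 x

/-- An injective numbering of formulas. -/
def code : Fml → ℕ
  | mem x y => Nat.pair 0 (Nat.pair x y)
  | eq x y => Nat.pair 1 (Nat.pair x y)
  | bot => Nat.pair 2 0
  | and φ ψ => Nat.pair 3 (Nat.pair (code φ) (code ψ))
  | or φ ψ => Nat.pair 4 (Nat.pair (code φ) (code ψ))
  | imp φ ψ => Nat.pair 5 (Nat.pair (code φ) (code ψ))
  | all φ => Nat.pair 6 (code φ)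
  | ex φ => Nat.pair 7 (code φ)

theorem code_injective : Function.Injective code := by
  intro φ
  induction φ with
  | mem x y | eq x y | bot => intro ψ h; cases ψ <;> simp [code, Nat.pair_eq_pair] at h ⊢ <;> exact h
  | and φ ψ h1 h2 | or φ ψ h1 h2 | imp φ ψ h1 h2 =>
    intro χ h
    cases χ <;> simp [code, Nat.pair_eq_pair] at h ⊢
    exact ⟨h1 h.1, h2 h.2⟩
  | all φ h1 | ex φ h1 =>
    intro χ h
    cases χ <;> simp [code, Nat.pair_eq_pair] at h ⊢
    exact h1 h

instance : Countable Fml := code_injective.countable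

instance : Nonempty Fml := ⟨bot⟩

end Fml

/-! ### Structural properties of derivations -/

/-- A set of axioms stable under injective renamings of the free variables. -/
def RenameClosed (T : Set Fml) : Prop := ∀ φ ∈ T, ∀ f : ℕ → ℕ, f.Injective → rename f φ ∈ T

theorem renameClosed_theory : RenameClosed theory := by
  rintro φ (rfl | ⟨ψ, hψ, rfl⟩) f hf
  · exact Or.inl rfl
  · refine Or.inr ⟨rename (lift f) ψ, hψ.rename (lift_injective hf), ?_⟩
    simp only [comprehension, rename, Fml.iff, rename_rename, lift_comp]
    rfl

variable {T : Set Fml}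

theorem Derives.weaken {l l' : List Fml} {φ : Fml} (h : Derives T l φ) (hl : l ⊆ l') :
    Derives T l' φ := by
  induction h generalizing l' with
  | ax h => exact .ax h
  | hyp h => exact .hyp (hl h)
  | botE _ ih => exact .botE (ih hl)
  | andI _ _ ih1 ih2 => exact .andI (ih1 hl) (ih2 hl)
  | andL _ ih => exact .andL (ih hl)
  | andR _ ih => exact .andR (ih hl)
  | orL _ ih => exact .orL (ih hl)
  | orR _ ih => exact .orR (ih hl)
  | orE _ _ _ ih ih1 ih2 =>
    exact .orE (ih hl) (ih1 (List.cons_subset_cons _ hl)) (ih2 (List.cons_subset_cons _ hl))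
  | impI _ ih => exact .impI (ih (List.cons_subset_cons _ hl))
  | impE _ _ ih1 ih2 => exact .impE (ih1 hl) (ih2 hl)
  | allI _ ih => exact .allI (ih (List.map_subset _ hl))
  | allE t _ ih => exact .allE t (ih hl)
  | exI t _ ih => exact .exI t (ih hl)
  | exE _ _ ih1 ih2 => exact .exE (ih1 hl) (ih2 (List.cons_subset_cons _ (List.map_subset _ hl)))
  | eqRefl t => exact .eqRefl t
  | eqSubst φ _ _ ih1 ih2 => exact .eqSubst φ (ih1 hl) (ih2 hl)

theorem map_rename_shift (f : ℕ → ℕ) (l : List Fml) :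
    (l.map shift).map (rename (lift f)) = (l.map (rename f)).map shift := by
  simp [rename_shift]

theorem Derives.rename (hT : RenameClosed T) {l : List Fml} {φ : Fml} (h : Derives T l φ)
    {f : ℕ → ℕ} (hf : f.Injective) : Derives T (l.map (rename f)) (rename f φ) := by
  induction h generalizing f with
  | ax h => exact .ax (hT _ h f hf)
  | hyp h => exact .hyp (List.mem_map_of_mem h)
  | botE _ ih => exact .botE (ih hf)
  | andI _ _ ih1 ih2 => exact .andI (ih1 hf) (ih2 hf)
  | andL _ ih => exact .andL (ih hf)
  | andR _ ih => exact .andR (ih hf)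
  | orL _ ih => exact .orL (ih hf)
  | orR _ ih => exact .orR (ih hf)
  | orE _ _ _ ih ih1 ih2 => exact .orE (ih hf) (ih1 hf) (ih2 hf)
  | impI _ ih => exact .impI (ih hf)
  | impE _ _ ih1 ih2 => exact .impE (ih1 hf) (ih2 hf)
  | allI _ ih =>
    refine .allI ?_
    rw [← map_rename_shift]
    exact ih (lift_injective hf)
  | allE t _ ih =>
    rw [rename_inst]
    exact .allE _ (ih hf)
  | exI t _ ih =>
    refine .exI (f t) ?_
    rw [← rename_inst]
    exact ih hf
  | exE _ _ ih1 ih2 =>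
    refine .exE (ih1 hf) ?_
    rw [← map_rename_shift, ← rename_shift]
    exact ih2 (lift_injective hf)
  | eqRefl t => exact .eqRefl _
  | eqSubst φ _ _ ih1 ih2 =>
    rw [rename_inst]
    refine .eqSubst _ (ih1 hf) ?_
    rw [← rename_inst]
    exact ih2 hf

/-- A derivation between formulas whose variables have been doubled can be undone. -/
theorem Derives.of_rename_double (hT : RenameClosed T) {l : List Fml} {φ : Fml}
    (h : Derives T (l.map (Fml.rename (2 * ·))) (Fml.rename (2 * ·) φ)) : Derives T l φ := by
  obtain ⟨n, hn⟩ := exists_occ_bound_list (φ :: l)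
  -- `g` halves the doubled variables that occur. All others go to values at least `n`, which keeps
  -- `g` injective, as the closure of the axioms under renaming requires.
  let g : ℕ → ℕ := fun y => if y % 2 = 0 ∧ y / 2 < n then y / 2 else y + n
  have hg : g.Injective := by
    intro a b hab
    simp only [g] at hab
    split_ifs at hab <;> omega
  have key : ∀ ψ ∈ φ :: l, Fml.rename g (Fml.rename (2 * ·) ψ) = ψ := by
    intro ψ hψ
    rw [rename_rename]
    refine rename_eq_self fun x hx => ?_
    have := hn ψ hψ x hx
    simp [g, this]
  have := h.rename hT hg
  rw [key φ List.mem_cons_self, List.map_map] at this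
  have hl : l.map (Fml.rename g ∘ Fml.rename (2 * ·)) = l := by
    conv_rhs => rw [← List.map_id l]
    exact List.map_congr_left fun ψ hψ => key ψ (List.mem_cons_of_mem _ hψ)
  rwa [hl] at this

/-- The renaming that moves the variable `c` to `0` and shifts the others. -/
def abstractMap (c : ℕ) : ℕ → ℕ := fun x => if x = c then 0 else x + 1

theorem abstractMap_injective (c : ℕ) : (abstractMap c).Injective := by
  intro a b h
  simp only [abstractMap] at h
  split_ifs at h <;> omega

theorem rename_abstractMap_of_fresh {c : ℕ} {φ : Fml} (h : ¬ Occ c φ) :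
    rename (abstractMap c) φ = φ.shift := by
  refine rename_congr fun x hx => ?_
  have : x ≠ c := by rintro rfl; exact h hx
  simp [abstractMap, this]

theorem rename_abstractMap_inst {c : ℕ} {φ : Fml} (h : ¬ Occ (c + 1) φ) :
    rename (abstractMap c) (φ.inst c) = φ := by
  rw [inst, rename_rename]
  refine rename_eq_self fun x hx => ?_
  cases x with
  | zero => simp [abstractMap, instMap]
  | succ k =>
    have : k ≠ c := by rintro rfl; exact h hx
    simp [abstractMap, instMap, this]

theorem map_abstractMap_of_fresh {c : ℕ} {l : List Fml} (h : ∀ ψ ∈ l, ¬ Occ c ψ) :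
    l.map (rename (abstractMap c)) = l.map shift :=
  List.map_congr_left fun ψ hψ => rename_abstractMap_of_fresh (h ψ hψ)

/-- The calculus binds the variable `0` in a shifted context. An arbitrary fresh variable `c` is
brought into that form by the injective renaming `abstractMap c`. -/
theorem Derives.allI_fresh (hT : RenameClosed T) {l : List Fml} {φ : Fml} {c : ℕ}
    (hl : ∀ ψ ∈ l, ¬ Occ c ψ) (hφ : ¬ Occ (c + 1) φ) (h : Derives T l (φ.inst c)) :
    Derives T l (all φ) := by
  have := h.rename hT (abstractMap_injective c)
  rw [map_abstractMap_of_fresh hl, rename_abstractMap_inst hφ] at this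
  exact .allI this

theorem Derives.exE_fresh (hT : RenameClosed T) {l : List Fml} {φ χ : Fml} {c : ℕ}
    (hl : ∀ ψ ∈ l, ¬ Occ c ψ) (hφ : ¬ Occ (c + 1) φ) (hχ : ¬ Occ c χ) (he : Derives T l (ex φ))
    (h : Derives T (φ.inst c :: l) χ) : Derives T l χ := by
  have := h.rename hT (abstractMap_injective c)
  rw [List.map_cons, map_abstractMap_of_fresh hl, rename_abstractMap_inst hφ,
    rename_abstractMap_of_fresh hχ] at this
  exact .exE he this

/-! ### Prime extensions -/

/-- Derivability from a possibly infinite set of assumptions. -/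
def Entails (T Γ : Set Fml) (φ : Fml) : Prop := ∃ l : List Fml, (∀ ψ ∈ l, ψ ∈ Γ) ∧ Derives T l φ

theorem Entails.mono {Γ Δ : Set Fml} {φ : Fml} (h : Entails T Γ φ) (hΓ : Γ ⊆ Δ) : Entails T Δ φ := by
  obtain ⟨l, hl, h⟩ := h
  exact ⟨l, fun ψ hψ => hΓ (hl ψ hψ), h⟩

theorem entails_of_mem {Γ : Set Fml} {φ : Fml} (h : φ ∈ Γ) : Entails T Γ φ :=
  ⟨[φ], by simpa using h, .hyp (by simp)⟩

theorem entails_insert {Γ : Set Fml} {φ χ : Fml} (h : Entails T (insert φ Γ) χ) :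
    ∃ l : List Fml, (∀ ψ ∈ l, ψ ∈ Γ) ∧ Derives T (φ :: l) χ := by
  classical
  obtain ⟨l, hl, h⟩ := h
  refine ⟨l.filter (· ≠ φ), ?_, h.weaken ?_⟩
  · intro ψ hψ
    simp only [ne_eq, decide_not, List.mem_filter, Bool.not_eq_eq_eq_not, Bool.not_true,
      decide_eq_false_iff_not] at hψ
    exact (hl ψ hψ.1).resolve_left hψ.2
  · intro ψ hψ
    by_cases e : ψ = φ
    · simp [e]
    · simp [hψ, e]

theorem Entails.impI {Γ : Set Fml} {φ χ : Fml} (h : Entails T (insert φ Γ) χ) :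
    Entails T Γ (φ ⟹ χ) := by
  obtain ⟨l, hl, h⟩ := entails_insert h
  exact ⟨l, hl, .impI h⟩

theorem Entails.impE {Γ : Set Fml} {φ χ : Fml} (h : Entails T Γ (φ ⟹ χ)) (h' : Entails T Γ φ) :
    Entails T Γ χ := by
  obtain ⟨l, hl, h⟩ := h
  obtain ⟨l', hl', h'⟩ := h'
  refine ⟨l ++ l', ?_, .impE (h.weaken (by simp)) (h'.weaken (by simp))⟩
  intro ψ hψ
  rcases List.mem_append.1 hψ with h | h
  · exact hl ψ h
  · exact hl' ψ h

theorem Entails.cut {Γ : Set Fml} {φ χ : Fml} (h : Entails T (insert φ Γ) χ) (h' : Entails T Γ φ) :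
    Entails T Γ χ := h.impI.impE h'

theorem Entails.of_derives {Γ : Set Fml} {l : List Fml} {φ : Fml} (h : Derives T l φ)
    (hl : ∀ ψ ∈ l, Entails T Γ ψ) : Entails T Γ φ := by
  induction l generalizing φ with
  | nil => exact ⟨[], by simp, h⟩
  | cons ψ l ih =>
    exact (ih (.impI h) fun χ hχ => hl χ (List.mem_cons_of_mem _ hχ)).impE (hl ψ List.mem_cons_self)

/-- Arbitrarily large variables do not occur in `Γ`. -/
def Roomy (Γ : Set Fml) : Prop := ∀ n, ∃ c ≥ n, ∀ ψ ∈ Γ, ¬ Occ c ψ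

theorem Roomy.insert {Γ : Set Fml} (h : Roomy Γ) (φ : Fml) : Roomy (insert φ Γ) := by
  intro n
  obtain ⟨m, hm⟩ := exists_occ_bound φ
  obtain ⟨c, hc, hc'⟩ := h (n + m)
  refine ⟨c, by omega, fun ψ hψ => ?_⟩
  rcases hψ with rfl | hψ
  · intro ho; have := hm c ho; omega
  · exact hc' ψ hψ

/-- One stage of the Henkin construction: `φ` is added unless that would make `χ` derivable, and an
added existential formula receives a fresh variable as witness at once. Finitely many new formulas
leave the set roomy for later stages. -/
theorem exists_henkin_step (hT : RenameClosed T) {χ : Fml} {Γ : Set Fml} (hr : Roomy Γ)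
    (hn : ¬ Entails T Γ χ) (φ : Fml) :
    ∃ Δ, Γ ⊆ Δ ∧ (Roomy Δ ∧ ¬ Entails T Δ χ) ∧
      (¬ Entails T (insert φ Γ) χ → φ ∈ Δ ∧ ∀ α, φ = ex α → ∃ c, α.inst c ∈ Δ) := by
  by_cases h : Entails T (insert φ Γ) χ
  · exact ⟨Γ, subset_rfl, ⟨hr, hn⟩, fun h' => (h' h).elim⟩
  by_cases he : ∃ α, φ = ex α
  · obtain ⟨α, rfl⟩ := he
    obtain ⟨m, hm⟩ := exists_occ_bound χ
    obtain ⟨c, hc, hc'⟩ := hr.insert (ex α) m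
    refine ⟨insert (α.inst c) (insert (ex α) Γ), ?_, ⟨(hr.insert _).insert _, fun h' => h ?_⟩, fun _ => ⟨?_, ?_⟩⟩
    · exact (Set.subset_insert _ _).trans (Set.subset_insert _ _)
    · obtain ⟨l, hl, h'⟩ := entails_insert h'
      have hl' : ∀ ψ ∈ ex α :: l, ψ ∈ insert (ex α) Γ := by
        intro ψ hψ
        rcases List.mem_cons.1 hψ with rfl | hψ
        · exact Set.mem_insert _ _
        · exact hl ψ hψ
      refine ⟨ex α :: l, hl', Derives.exE_fresh hT (φ := α) (c := c) (fun ψ hψ => hc' ψ (hl' ψ hψ))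
        (hc' (ex α) (Set.mem_insert _ _)) (fun ho => ?_) (.hyp (by simp)) (h'.weaken ?_)⟩
      · have := hm c ho; omega
      · exact List.cons_subset_cons _ (List.subset_cons_self _ _)
    · exact Set.mem_insert_of_mem _ (Set.mem_insert _ _)
    · rintro β hβ
      cases hβ
      exact ⟨c, Set.mem_insert _ _⟩
  · refine ⟨insert φ Γ, Set.subset_insert _ _, ⟨hr.insert φ, h⟩, fun _ => ⟨Set.mem_insert _ _, ?_⟩⟩
    intro α hα
    exact (he ⟨α, hα⟩).elim

/-- A prime theory with witnesses for its existential members. -/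
structure PrimeTheory (T : Set Fml) where
  carrier : Set Fml
  closed : ∀ {l : List Fml} {φ : Fml}, Derives T l φ → (∀ ψ ∈ l, ψ ∈ carrier) → φ ∈ carrier
  bot_notMem : bot ∉ carrier
  prime : ∀ {φ ψ : Fml}, (φ ⋎ ψ) ∈ carrier → φ ∈ carrier ∨ ψ ∈ carrier
  witness : ∀ {φ : Fml}, ex φ ∈ carrier → ∃ t, φ.inst t ∈ carrier

theorem exists_primeTheory (hT : RenameClosed T) {χ : Fml} {Γ : Set Fml} (hr : Roomy Γ)
    (hn : ¬ Entails T Γ χ) : ∃ w : PrimeTheory T, Γ ⊆ w.carrier ∧ χ ∉ w.carrier := by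
  obtain ⟨e, he⟩ := exists_surjective_nat Fml
  choose! F hF1 hF2 hF3 using
    fun (Δ : Set Fml) (h : Roomy Δ ∧ ¬ Entails T Δ χ) (φ : Fml) => exists_henkin_step hT h.1 h.2 φ
  let G : ℕ → Set Fml := fun n => Nat.rec Γ (fun n Δ => F Δ (e n)) n
  have hG : ∀ n, Roomy (G n) ∧ ¬ Entails T (G n) χ := by
    intro n
    induction n with
    | zero => exact ⟨hr, hn⟩
    | succ n ih => exact hF2 _ ih _
  have hmono : Monotone G := monotone_nat_of_le_succ fun n => hF1 _ (hG n) _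
  have hfin : ∀ l : List Fml, (∀ ψ ∈ l, ψ ∈ ⋃ n, G n) → ∃ n, ∀ ψ ∈ l, ψ ∈ G n := by
    intro l
    induction l with
    | nil => intro _; exact ⟨0, by simp⟩
    | cons φ l ih =>
      intro h
      obtain ⟨n, hn⟩ := ih fun ψ hψ => h ψ (List.mem_cons_of_mem _ hψ)
      obtain ⟨m, hm⟩ := Set.mem_iUnion.1 (h φ List.mem_cons_self)
      refine ⟨max n m, fun ψ hψ => ?_⟩
      rcases List.mem_cons.1 hψ with rfl | hψ
      · exact hmono (le_max_right _ _) hm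
      · exact hmono (le_max_left _ _) (hn ψ hψ)
  have hU : ¬ Entails T (⋃ n, G n) χ := by
    rintro ⟨l, hl, h⟩
    obtain ⟨n, hn⟩ := hfin l hl
    exact (hG n).2 ⟨l, hn, h⟩
  have hmem : ∀ n, ¬ Entails T (insert (e n) (⋃ n, G n)) χ →
      e n ∈ G (n + 1) ∧ ∀ α, e n = ex α → ∃ c, α.inst c ∈ G (n + 1) := by
    intro n h
    exact hF3 _ (hG n) (e n) fun h' => h (h'.mono (Set.insert_subset_insert (Set.subset_iUnion G n)))
  -- The union is maximal among the sets that do not entail `χ`: a formula left out would yield `χ`.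
  have hmem' : ∀ φ, ¬ Entails T (insert φ (⋃ n, G n)) χ → φ ∈ ⋃ n, G n := by
    intro φ h
    obtain ⟨n, rfl⟩ := he φ
    exact Set.mem_iUnion.2 ⟨n + 1, (hmem n h).1⟩
  have hcl : ∀ φ, Entails T (⋃ n, G n) φ → φ ∈ ⋃ n, G n := by
    intro φ h
    exact hmem' φ fun h' => hU (h'.cut h)
  refine ⟨⟨⋃ n, G n, ?_, ?_, ?_, ?_⟩, Set.subset_iUnion G 0, fun h => hU (entails_of_mem h)⟩
  · intro l φ h hl
    exact hcl φ ⟨l, hl, h⟩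
  · intro h
    exact hU (.of_derives (l := [bot]) (.botE (.hyp (by simp))) (by simpa using entails_of_mem h))
  · intro φ ψ h
    -- By maximality each missing disjunct yields `χ`, hence so does the disjunction, which is in
    -- the union.
    by_contra! hc
    have h1 := Entails.impI (not_not.1 fun h' => hc.1 (hmem' φ h'))
    have h2 := Entails.impI (not_not.1 fun h' => hc.2 (hmem' ψ h'))
    refine hU (.of_derives (l := [φ ⋎ ψ, φ ⟹ χ, ψ ⟹ χ])
      (.orE (φ := φ) (ψ := ψ) (.hyp (by simp)) (.impE (φ := φ) (.hyp (by simp)) (.hyp (by simp)))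
        (.impE (φ := ψ) (.hyp (by simp)) (.hyp (by simp)))) ?_)
    intro θ hθ
    simp only [List.mem_cons, List.not_mem_nil, or_false] at hθ
    rcases hθ with rfl | rfl | rfl
    · exact entails_of_mem h
    · exact h1
    · exact h2
  · intro φ h
    -- At the stage that treats `ex φ`, adding it is harmless because it already belongs to the
    -- union; so that stage supplied a witness.
    obtain ⟨n, hn⟩ := he (ex φ)
    have := (hmem n ?_).2 φ hn
    · obtain ⟨c, hc⟩ := this
      exact ⟨c, Set.mem_iUnion.2 ⟨n + 1, hc⟩⟩
    · rw [hn, Set.insert_eq_of_mem h]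
      exact hU

/-! ### Kripke models -/

/-- Extension of an assignment by the value of a newly bound variable. -/
def scons {α : Type*} (a : α) (e : ℕ → α) : ℕ → α
  | 0 => a
  | k + 1 => e k

@[simp] theorem scons_zero {α : Type*} (a : α) (e : ℕ → α) : scons a e 0 = a := rfl

@[simp] theorem scons_succ {α : Type*} (a : α) (e : ℕ → α) (k : ℕ) : scons a e (k + 1) = e k := rfl

theorem scons_head_tail {α : Type*} (e : ℕ → α) : scons (e 0) (fun k => e (k + 1)) = e := by
  funext k; cases k <;> rfl

theorem comp_scons {α β : Type*} (f : α → β) (a : α) (e : ℕ → α) :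
    (fun k => f (scons a e k)) = scons (f a) (fun k => f (e k)) := by
  funext k; cases k <;> rfl

/-- A Kripke model of the language of set theory over a category of worlds. Equality at a world is
equality of elements of its domain. -/
structure KModel where
  W : Type
  Hom : W → W → Type
  id : ∀ w, Hom w w
  comp : ∀ {u v w}, Hom u v → Hom v w → Hom u w
  D : W → Type
  nonempty : ∀ w, Nonempty (D w)
  map : ∀ {v w}, Hom v w → D v → D w
  map_id : ∀ {w} (x : D w), map (id w) x = x
  map_comp : ∀ {u v w} (m : Hom u v) (m' : Hom v w) (x : D u), map (comp m m') x = map m' (map m x)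
  Mem : ∀ {w}, D w → D w → Prop
  mem_map : ∀ {v w} (m : Hom v w) {x y : D v}, Mem x y → Mem (map m x) (map m y)

namespace KModel

attribute [simp] map_id map_comp

instance (M : KModel) (w : M.W) : Nonempty (M.D w) := M.nonempty w

/-- Forcing of a formula under an assignment at a world. -/
def Forces (M : KModel) : (w : M.W) → (ℕ → M.D w) → Fml → Prop
  | _, e, .mem x y => M.Mem (e x) (e y)
  | _, e, .eq x y => e x = e y
  | _, _, .bot => False
  | w, e, .and φ ψ => M.Forces w e φ ∧ M.Forces w e ψ
  | w, e, .or φ ψ => M.Forces w e φ ∨ M.Forces w e ψ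
  | w, e, .imp φ ψ => ∀ w' (m : M.Hom w w'), M.Forces w' (fun k => M.map m (e k)) φ →
      M.Forces w' (fun k => M.map m (e k)) ψ
  | w, e, .all φ => ∀ w' (m : M.Hom w w') (d : M.D w'),
      M.Forces w' (scons d (fun k => M.map m (e k))) φ
  | w, e, .ex φ => ∃ d : M.D w, M.Forces w (scons d e) φ

variable {M : KModel}

theorem Forces.map {φ : Fml} : ∀ {w w' : M.W} (m : M.Hom w w') {e : ℕ → M.D w},
    M.Forces w e φ → M.Forces w' (fun k => M.map m (e k)) φ := by
  induction φ with
  | mem x y => intro w w' m e h; exact M.mem_map m h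
  | eq x y => intro w w' m e h; exact congrArg (M.map m) h
  | bot => intro w w' m e h; exact h
  | and φ ψ h1 h2 => intro w w' m e h; exact ⟨h1 m h.1, h2 m h.2⟩
  | or φ ψ h1 h2 => intro w w' m e h; exact h.imp (h1 m) (h2 m)
  | imp φ ψ h1 h2 =>
    intro w w' m e h v m' h'
    have := h v (M.comp m m')
    simp only [map_comp] at this
    exact this h'
  | all φ h1 =>
    intro w w' m e h v m' d
    have := h v (M.comp m m') d
    simp only [map_comp] at this
    exact this
  | ex φ h1 =>
    intro w w' m e h
    obtain ⟨d, h⟩ := h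
    refine ⟨M.map m d, ?_⟩
    rw [← comp_scons]
    exact h1 m h

end KModel

/-! ### Completeness -/

namespace PrimeTheory

variable {T : Set Fml}

/-- Equality of variables according to a prime theory. -/
def setoid (w : PrimeTheory T) : Setoid ℕ where
  r x y := (x ≐ y) ∈ w.carrier
  iseqv :=
    { refl := fun x => w.closed (.eqRefl (Γ := []) x) (by simp)
      symm := fun {x y} h => w.closed (l := [x ≐ y]) (φ := y ≐ x)
        (.eqSubst (0 ≐ (x + 1)) (s := x) (t := y) (.hyp (by simp)) (.eqRefl x)) (by simpa using h)
      trans := fun {x y z} h h' => w.closed (l := [x ≐ y, y ≐ z]) (φ := x ≐ z)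
        (.eqSubst ((x + 1) ≐ 0) (s := y) (t := z) (.hyp (by simp)) (.hyp (by simp [inst, rename, instMap])))
        (by simpa using ⟨h, h'⟩) }

theorem mem_congr (w : PrimeTheory T) {x y x' y' : ℕ} (hx : (x ≐ x') ∈ w.carrier)
    (hy : (y ≐ y') ∈ w.carrier) (h : (x ∊ y) ∈ w.carrier) : (x' ∊ y') ∈ w.carrier := by
  have h1 : (x' ∊ y) ∈ w.carrier := w.closed (l := [x ≐ x', x ∊ y]) (φ := x' ∊ y)
    (.eqSubst (0 ∊ (y + 1)) (s := x) (t := x') (.hyp (by simp)) (.hyp (by simp [inst, rename, instMap])))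
    (by simpa using ⟨hx, h⟩)
  exact w.closed (l := [y ≐ y', x' ∊ y]) (φ := x' ∊ y')
    (.eqSubst ((x' + 1) ∊ 0) (s := y) (t := y') (.hyp (by simp)) (.hyp (by simp [inst, rename, instMap])))
    (by simpa using ⟨hy, h1⟩)

/-- For the converse, the theory is copied onto the even variables before `φ` is added and the
result is extended to a prime theory omitting `ψ`. The unused odd variables serve as witnesses, and
`Derives.of_rename_double` carries a supposed derivation back. -/
theorem imp_mem_iff (hT : RenameClosed T) (w : PrimeTheory T) {φ ψ : Fml} :
    (φ ⟹ ψ) ∈ w.carrier ↔ ∀ (w' : PrimeTheory T) (f : ℕ → ℕ),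
      (∀ χ ∈ w.carrier, rename f χ ∈ w'.carrier) →
        rename f φ ∈ w'.carrier → rename f ψ ∈ w'.carrier := by
  constructor
  · intro h w' f hf h'
    exact w'.closed (l := [rename f (φ ⟹ ψ), rename f φ])
      (.impE (φ := rename f φ) (.hyp (by simp [rename])) (.hyp (by simp))) (by simpa using ⟨hf _ h, h'⟩)
  · intro h
    by_contra hn
    have hr : Roomy (insert (rename (2 * ·) φ) (rename (2 * ·) '' w.carrier)) := by
      refine Roomy.insert ?_ _
      intro n
      refine ⟨2 * n + 1, by omega, ?_⟩
      rintro _ ⟨χ, -, rfl⟩ ho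
      obtain ⟨x, -, hx⟩ := ho.of_rename
      omega
    have hne : ¬ Entails T (insert (rename (2 * ·) φ) (rename (2 * ·) '' w.carrier))
        (rename (2 * ·) ψ) := by
      intro he
      obtain ⟨l, hl, hd⟩ := he.impI
      obtain ⟨l', hl', rfl⟩ : ∃ l' : List Fml, (∀ χ ∈ l', χ ∈ w.carrier) ∧
          l'.map (rename (2 * ·)) = l := by
        choose! g hg1 hg2 using hl
        refine ⟨l.map g, by simpa using hg1, ?_⟩
        rw [List.map_map]
        conv_rhs => rw [← List.map_id l]
        exact List.map_congr_left hg2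
      exact hn (w.closed (Derives.of_rename_double hT (φ := φ ⟹ ψ) hd) hl')
    obtain ⟨w', hw', hψ⟩ := exists_primeTheory hT hr hne
    exact hψ (h w' (2 * ·) (fun χ hχ => hw' (Set.mem_insert_of_mem _ ⟨χ, hχ, rfl⟩))
      (hw' (Set.mem_insert _ _)))

theorem all_mem_iff (hT : RenameClosed T) (w : PrimeTheory T) {φ : Fml} :
    all φ ∈ w.carrier ↔ ∀ (w' : PrimeTheory T) (f : ℕ → ℕ),
      (∀ χ ∈ w.carrier, rename f χ ∈ w'.carrier) →
        ∀ t, (rename (lift f) φ).inst t ∈ w'.carrier := by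
  constructor
  · intro h w' f hf t
    exact w'.closed (l := [rename f (all φ)]) (.allE t (.hyp (by simp [rename])))
      (by simpa using hf _ h)
  · intro h
    by_contra hn
    have hr' : ∀ c, c % 2 = 1 → ∀ χ, ¬ Occ c (rename (2 * ·) χ) := by
      intro c hc χ ho
      obtain ⟨x, -, hx⟩ := ho.of_rename
      omega
    have hr : Roomy (rename (2 * ·) '' w.carrier) := by
      intro n
      refine ⟨2 * n + 1, by omega, ?_⟩
      rintro _ ⟨χ, -, rfl⟩
      exact hr' _ (by omega) _
    -- The variable `1` is odd, so it occurs in no doubled formula and acts as a generic element.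
    have hne : ¬ Entails T (rename (2 * ·) '' w.carrier)
        ((rename (lift (2 * ·)) φ).inst 1) := by
      rintro ⟨l, hl, hd⟩
      obtain ⟨l', hl', rfl⟩ : ∃ l' : List Fml, (∀ χ ∈ l', χ ∈ w.carrier) ∧
          l'.map (rename (2 * ·)) = l := by
        choose! g hg1 hg2 using hl
        refine ⟨l.map g, by simpa using hg1, ?_⟩
        rw [List.map_map]
        conv_rhs => rw [← List.map_id l]
        exact List.map_congr_left hg2
      refine hn (w.closed (Derives.of_rename_double hT (φ := all φ) ?_) hl')
      refine Derives.allI_fresh hT (c := 1) ?_ (hr' 1 rfl (all φ)) hd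
      intro ψ hψ
      obtain ⟨χ, -, rfl⟩ := List.mem_map.1 hψ
      exact hr' 1 rfl χ
    obtain ⟨w', hw', hψ⟩ := exists_primeTheory hT hr hne
    exact hψ (h w' (2 * ·) (fun χ hχ => hw' ⟨χ, hχ, rfl⟩) 1)

end PrimeTheory

/-- The Kripke model of the prime theories over `T`, with renamings as morphisms. -/
def canonicalModel (T : Set Fml) : KModel where
  W := PrimeTheory T
  Hom v w := {f : ℕ → ℕ // ∀ φ ∈ v.carrier, rename f φ ∈ w.carrier}
  id w := ⟨id, fun φ hφ => by rwa [rename_id]⟩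
  comp f g := ⟨g.1 ∘ f.1, fun φ hφ => by
    rw [← rename_rename]
    exact g.2 _ (f.2 _ hφ)⟩
  D w := Quotient w.setoid
  nonempty w := ⟨Quotient.mk w.setoid 0⟩
  map f := Quotient.map f.1 fun x y h => f.2 _ h
  map_id := by rintro w ⟨x⟩; rfl
  map_comp := by rintro u v w m m' ⟨x⟩; rfl
  Mem {w} := Quotient.lift₂ (fun x y => (x ∊ y) ∈ w.carrier) fun _ _ _ _ hx hy =>
    propext ⟨w.mem_congr hx hy, w.mem_congr (w.setoid.symm hx) (w.setoid.symm hy)⟩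
  mem_map := by rintro v w m ⟨x⟩ ⟨y⟩ h; exact m.2 _ h

/-- The truth lemma. An assignment into the quotient is represented by a map `s` of variables, so
that evaluating `φ` amounts to renaming it. -/
theorem forces_canonicalModel_iff {T : Set Fml} (hT : RenameClosed T) (φ : Fml) :
    ∀ (w : PrimeTheory T) (s : ℕ → ℕ) (e : ℕ → (canonicalModel T).D w),
      (∀ k, e k = Quotient.mk w.setoid (s k)) →
        ((canonicalModel T).Forces w e φ ↔ rename s φ ∈ w.carrier) := by
  have hinst : ∀ (φ : Fml) (s : ℕ → ℕ) (t : ℕ),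
      (rename (lift s) φ).inst t = rename (scons t s) φ := by
    intro φ s t
    rw [inst, rename_rename]
    congr 1
    funext k; cases k <;> rfl
  induction φ with
  | mem x y => intro w s e he; simp only [KModel.Forces, he]; exact Iff.rfl
  | eq x y =>
    intro w s e he
    simp only [KModel.Forces, he]
    exact Quotient.eq (r := w.setoid)
  | bot => intro w s e he; exact ⟨False.elim, w.bot_notMem⟩
  | and φ ψ h1 h2 =>
    intro w s e he
    refine (and_congr (h1 w s e he) (h2 w s e he)).trans ⟨fun h => ?_, fun h => ⟨?_, ?_⟩⟩
    · exact w.closed (l := [rename s φ, rename s ψ]) (.andI (.hyp (by simp)) (.hyp (by simp)))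
        (by simpa using h)
    · exact w.closed (l := [rename s (φ ⋏ ψ)]) (.andL (.hyp (by simp [rename]; rfl))) (by simpa using h)
    · exact w.closed (l := [rename s (φ ⋏ ψ)]) (.andR (.hyp (by simp [rename]; rfl))) (by simpa using h)
  | or φ ψ h1 h2 =>
    intro w s e he
    refine (or_congr (h1 w s e he) (h2 w s e he)).trans ⟨fun h => ?_, fun h => w.prime h⟩
    rcases h with h | h
    · exact w.closed (l := [rename s φ]) (.orL (.hyp (by simp))) (by simpa using h)
    · exact w.closed (l := [rename s ψ]) (.orR (.hyp (by simp))) (by simpa using h)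
  | imp φ ψ h1 h2 =>
    intro w s e he
    refine Iff.trans ?_ (w.imp_mem_iff hT).symm
    have key : ∀ (w' : PrimeTheory T) (m : (canonicalModel T).Hom w w') k,
        (canonicalModel T).map m (e k) = Quotient.mk w'.setoid ((m.1 ∘ s) k) := by
      intro w' m k; rw [he]; rfl
    constructor
    · intro h w' f hf h'
      rw [rename_rename] at h' ⊢
      exact (h2 w' _ _ (key w' ⟨f, hf⟩)).1 (h w' ⟨f, hf⟩ ((h1 w' _ _ (key w' ⟨f, hf⟩)).2 h'))
    · intro h w' m h'
      refine (h2 w' _ _ (key w' m)).2 ?_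
      have := (h1 w' _ _ (key w' m)).1 h'
      rw [← rename_rename] at this ⊢
      exact h w' m.1 m.2 this
  | all φ h1 =>
    intro w s e he
    refine Iff.trans ?_ (w.all_mem_iff hT).symm
    have key : ∀ (w' : PrimeTheory T) (m : (canonicalModel T).Hom w w') (t k : ℕ),
        (scons (Quotient.mk w'.setoid t) (fun k => (canonicalModel T).map m (e k)) :
            ℕ → (canonicalModel T).D w') k =
          Quotient.mk w'.setoid (scons t (m.1 ∘ s) k) := by
      intro w' m t k
      cases k with
      | zero => rfl
      | succ k => exact congrArg ((canonicalModel T).map m) (he k)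
    have key2 : ∀ (f : ℕ → ℕ) (t : ℕ),
        (rename (lift f) (rename (lift s) φ)).inst t = rename (scons t (f ∘ s)) φ := by
      intro f t
      rw [rename_rename, lift_comp, hinst]
    constructor
    · intro h w' f hf t
      rw [key2]
      exact (h1 w' _ _ (key w' ⟨f, hf⟩ t)).1 (h w' ⟨f, hf⟩ (Quotient.mk w'.setoid t))
    · rintro h w' m ⟨t⟩
      refine (h1 w' _ _ (key w' m t)).2 ?_
      rw [← key2]
      exact h w' m.1 m.2 t
  | ex φ h1 =>
    intro w s e he
    have key : ∀ t k : ℕ, (scons (Quotient.mk w.setoid t) e : ℕ → (canonicalModel T).D w) k =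
          Quotient.mk w.setoid (scons t s k) := by
      intro t k
      cases k with
      | zero => rfl
      | succ k => exact he k
    constructor
    · rintro ⟨⟨t⟩, h⟩
      have h' := (h1 w _ _ (key t)).1 h
      rw [← hinst] at h'
      exact w.closed (l := [(rename (lift s) φ).inst t]) (.exI t (.hyp (by simp))) (by simpa using h')
    · intro h
      obtain ⟨t, ht⟩ := w.witness h
      rw [hinst] at ht
      exact ⟨_, (h1 w _ _ (key t)).2 ht⟩

/-- An assignment may identify variables, while derivations are stable only under injective
renamings. So the free variables are first bound one at a time, by induction on `n`; a closed
formula is unaffected by renaming. -/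
theorem forces_canonicalModel_of_derives {T : Set Fml} (hT : RenameClosed T) {n : ℕ} :
    ∀ {φ : Fml}, (∀ x, Occ x φ → x < n) → Derives T [] φ →
      ∀ (w : PrimeTheory T) (e : ℕ → (canonicalModel T).D w), (canonicalModel T).Forces w e φ := by
  induction n with
  | zero =>
    intro φ hφ h w e
    refine (forces_canonicalModel_iff hT φ w (fun k => Quotient.out (s := w.setoid) (e k)) e
      fun k => (Quotient.out_eq (s := w.setoid) (e k)).symm).2 ?_
    rw [rename_eq_self fun x hx => absurd (hφ x hx) (by omega)]
    exact w.closed h (by simp)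
  | succ n ih =>
    intro φ hφ h w e
    have := ih (φ := all φ) (fun x hx => by have := hφ _ hx; omega) (.allI h) w (fun k => e (k + 1))
      w ((canonicalModel T).id w) (e 0)
    have he : (fun k => (canonicalModel T).map ((canonicalModel T).id w) (e (k + 1))) =
        fun k => e (k + 1) := funext fun k => (canonicalModel T).map_id _
    rw [← scons_head_tail e, ← he]
    exact this

/-- Completeness of intuitionistic deduction for Kripke models. -/
theorem derives_of_forces {T : Set Fml} (hT : RenameClosed T) {φ : Fml}
    (h : ∀ M : KModel, (∀ ψ ∈ T, ∀ w e, M.Forces w e ψ) → ∀ w e, M.Forces w e φ) :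
    Derives T [] φ := by
  by_contra hn
  obtain ⟨w, -, hw⟩ := exists_primeTheory hT (Γ := ∅) (χ := φ) (fun n => ⟨n, le_rfl, by simp⟩) (by
    rintro ⟨l, hl, hd⟩
    rw [List.eq_nil_iff_forall_not_mem.2 hl] at hd
    exact hn hd)
  refine hw ?_
  have := (forces_canonicalModel_iff hT φ w id _ fun _ => rfl).1
    (h (canonicalModel T) (fun ψ hψ w e => ?_) w _)
  · rwa [rename_id] at this
  · obtain ⟨n, hn⟩ := exists_occ_bound ψ
    exact forces_canonicalModel_of_derives hT hn (.ax hψ) w e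

infixr:75 " ▷ " => KModel.map _
infix:50 " ε " => KModel.Mem _

/-! ### Stratification of the defined notions -/

section Stratification

variable {σ : ℕ → ℕ}

@[simp] theorem cons_zero (t : ℕ) : cons t σ 0 = t := rfl

@[simp] theorem cons_succ (t k : ℕ) : cons t σ (k + 1) = σ k := rfl

theorem stratifiedBy_iff (φ ψ : Fml) :
    StratifiedBy σ (φ ⟺ ψ) ↔ StratifiedBy σ φ ∧ StratifiedBy σ ψ := by
  simp only [Fml.iff, StratifiedBy]; tauto

theorem stratifiedBy_neg (φ : Fml) : StratifiedBy σ (∼φ) ↔ StratifiedBy σ φ := by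
  simp only [Fml.neg, StratifiedBy]; tauto

theorem stratifiedBy_isSingleton {s x : ℕ} : StratifiedBy σ (isSingleton s x) ↔ σ s = σ x + 1 := by
  simp only [isSingleton, stratifiedBy_iff, StratifiedBy, cons_zero, cons_succ]
  exact ⟨fun ⟨t, h⟩ => by omega, fun h => ⟨σ x, by omega⟩⟩

theorem stratifiedBy_isUPair {s x y : ℕ} :
    StratifiedBy σ (isUPair s x y) ↔ σ y = σ x ∧ σ s = σ x + 1 := by
  simp only [isUPair, stratifiedBy_iff, StratifiedBy, cons_zero, cons_succ]
  exact ⟨fun ⟨t, h⟩ => by omega, fun h => ⟨σ x, by omega⟩⟩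

theorem stratifiedBy_isPair {p x y : ℕ} :
    StratifiedBy σ (isPair p x y) ↔ σ y = σ x ∧ σ p = σ x + 2 := by
  simp only [isPair, stratifiedBy_iff, stratifiedBy_isSingleton, stratifiedBy_isUPair, StratifiedBy,
    cons_zero, cons_succ]
  exact ⟨fun ⟨t, h⟩ => by omega, fun h => ⟨σ x + 1, by omega⟩⟩

theorem stratifiedBy_pairIn {x y f : ℕ} :
    StratifiedBy σ (pairIn x y f) ↔ σ y = σ x ∧ σ f = σ x + 3 := by
  simp only [pairIn, stratifiedBy_isPair, StratifiedBy, cons_zero, cons_succ]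
  exact ⟨fun ⟨t, h⟩ => by omega, fun h => ⟨σ x + 2, by omega⟩⟩

/-- The double singleton lifts `z` to the level of the pair `⟨x, y⟩`, which lets all three
components share one index. -/
theorem stratifiedBy_isTriple {t x y z : ℕ} :
    StratifiedBy σ (isTriple t x y z) ↔ σ y = σ x ∧ σ z = σ x ∧ σ t = σ x + 4 := by
  simp only [isTriple, stratifiedBy_isPair, stratifiedBy_isSingleton, StratifiedBy, cons_zero,
    cons_succ]
  exact ⟨fun ⟨a, b, c, h⟩ => by omega,
    fun h => ⟨σ x + 2, σ x + 1, σ x + 2, by omega⟩⟩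

theorem stratifiedBy_tripleIn {x y z A : ℕ} :
    StratifiedBy σ (tripleIn x y z A) ↔ σ y = σ x ∧ σ z = σ x ∧ σ A = σ x + 5 := by
  simp only [tripleIn, stratifiedBy_isTriple, StratifiedBy, cons_zero, cons_succ]
  exact ⟨fun ⟨t, h⟩ => by omega, fun h => ⟨σ x + 4, by omega⟩⟩

/-- Arguments lie three levels below a function, two for the pair and one for membership; indices
are natural numbers, hence the lower bound. -/
theorem stratifiedBy_isFunc {f : ℕ} : StratifiedBy σ (isFunc f) ↔ 3 ≤ σ f := by
  simp only [isFunc, stratifiedBy_pairIn, StratifiedBy, cons_zero, cons_succ]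
  exact ⟨fun ⟨a, b, c, h⟩ => by omega,
    fun h => ⟨σ f - 3, σ f - 3, σ f - 3, by omega⟩⟩

theorem stratifiedBy_isIterSucc {p f z : ℕ} :
    StratifiedBy σ (isIterSucc p f z) ↔ 3 ≤ σ f ∧ σ p = σ f ∧ σ z = σ f + 3 := by
  simp only [isIterSucc, stratifiedBy_iff, stratifiedBy_pairIn, stratifiedBy_isPair,
    stratifiedBy_isFunc, StratifiedBy, cons_zero, cons_succ]
  exact ⟨fun ⟨u, h1, x, w, t, q, h⟩ => by omega,
    fun h => ⟨σ f - 1, by omega, σ f - 3, σ f - 3, σ f, σ f - 3, by omega⟩⟩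

/-- A Church number lies three levels above the functions it acts on, which lie three above their
arguments: hence `6`. That `v` and `z` share an index is what makes closure under successor
stratified. -/
theorem stratifiedBy_isSucc {v z : ℕ} :
    StratifiedBy σ (isSucc v z) ↔ 6 ≤ σ z ∧ σ v = σ z := by
  simp only [isSucc, stratifiedBy_iff, stratifiedBy_isIterSucc, stratifiedBy_isPair,
    stratifiedBy_isFunc, StratifiedBy, cons_zero, cons_succ]
  exact ⟨fun ⟨h0, u, h1, f, p, h⟩ => by omega,
    fun h => ⟨by omega, σ z - 1, by omega, σ z - 3, σ z - 3, by omega⟩⟩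

theorem stratifiedBy_isId {i : ℕ} : StratifiedBy σ (isId i) ↔ 3 ≤ σ i := by
  simp only [isId, stratifiedBy_iff, stratifiedBy_isPair, StratifiedBy, cons_zero, cons_succ]
  exact ⟨fun ⟨u, h1, x, h⟩ => by omega,
    fun h => ⟨σ i - 1, by omega, σ i - 3, by simp; omega⟩⟩

theorem stratifiedBy_isZero {o : ℕ} : StratifiedBy σ (isZero o) ↔ 6 ≤ σ o := by
  simp only [isZero, stratifiedBy_iff, stratifiedBy_isPair, stratifiedBy_isId, StratifiedBy,
    cons_zero, cons_succ]
  exact ⟨fun ⟨u, h1, f, i, h⟩ => by omega,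
    fun h => ⟨σ o - 1, by omega, σ o - 3, σ o - 3, by omega⟩⟩

theorem stratifiedBy_zeroIn {X : ℕ} : StratifiedBy σ (zeroIn X) ↔ 7 ≤ σ X := by
  simp only [zeroIn, stratifiedBy_isZero, StratifiedBy, cons_zero, cons_succ]
  exact ⟨fun ⟨t, h⟩ => by omega, fun h => ⟨σ X - 1, by omega⟩⟩

theorem stratifiedBy_succIn {u X : ℕ} :
    StratifiedBy σ (succIn u X) ↔ 6 ≤ σ u ∧ σ X = σ u + 1 := by
  simp only [succIn, stratifiedBy_isSucc, StratifiedBy, cons_zero, cons_succ]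
  exact ⟨fun ⟨t, h⟩ => by omega, fun h => ⟨σ u, by omega⟩⟩

theorem stratifiedBy_sameSucc {a b : ℕ} :
    StratifiedBy σ (sameSucc a b) ↔ 6 ≤ σ a ∧ σ b = σ a := by
  simp only [sameSucc, stratifiedBy_isSucc, StratifiedBy, cons_zero, cons_succ]
  exact ⟨fun ⟨t, h⟩ => by omega, fun h => ⟨σ a, by omega⟩⟩

theorem stratifiedBy_succClosed {X : ℕ} : StratifiedBy σ (succClosed X) ↔ 7 ≤ σ X := by
  simp only [succClosed, stratifiedBy_succIn, StratifiedBy, cons_zero, cons_succ]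
  exact ⟨fun ⟨t, h⟩ => by omega, fun h => ⟨σ X - 1, by omega⟩⟩

theorem stratifiedBy_succNotDouble {u N : ℕ} :
    StratifiedBy σ (succNotDouble u N) ↔ 6 ≤ σ u ∧ σ N = σ u + 1 := by
  simp only [succNotDouble, stratifiedBy_sameSucc, StratifiedBy, cons_zero, cons_succ]
  exact ⟨fun ⟨t, h⟩ => by omega, fun h => ⟨σ u, by omega⟩⟩

end Stratification

/-! ### Forcing of connected quantifiers and implications -/

namespace KModel

variable {M : KModel}

theorem map_scons {v w : M.W} (m : M.Hom v w) (a : M.D v) (e : ℕ → M.D v) :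
    (fun k => m ▷ scons a e k) = scons (m ▷ a) (fun k => m ▷ e k) :=
  comp_scons _ _ _

theorem map_map_scons {u v w : M.W} (m : M.Hom u v) (m' : M.Hom v w) (a : M.D u) (e : ℕ → M.D u) :
    (fun k => m' ▷ m ▷ scons a e k) = scons (m' ▷ m ▷ a) (fun k => m' ▷ m ▷ e k) :=
  comp_scons (fun x => m' ▷ m ▷ x) _ _

theorem forces_rename {φ : Fml} : ∀ {w : M.W} {e : ℕ → M.D w} {f : ℕ → ℕ},
    M.Forces w e (rename f φ) ↔ M.Forces w (fun k => e (f k)) φ := by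
  have key : ∀ {w : M.W} (d : M.D w) (e : ℕ → M.D w) (f : ℕ → ℕ),
      (fun k => scons d e (lift f k)) = scons d (fun k => e (f k)) := by
    intro w d e f; funext k; cases k <;> rfl
  induction φ with
  | mem x y | eq x y | bot => intros; exact Iff.rfl
  | and φ ψ h1 h2 => intros; exact and_congr h1 h2
  | or φ ψ h1 h2 => intros; exact or_congr h1 h2
  | imp φ ψ h1 h2 => intros; exact forall_congr' fun w' => forall_congr' fun m => imp_congr h1 h2
  | all φ h1 =>
    intro w e f
    refine forall_congr' fun w' => forall_congr' fun m => forall_congr' fun d => ?_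
    rw [h1, key]
  | ex φ h1 =>
    intro w e f
    refine exists_congr fun d => ?_
    rw [h1, key]

/-- Both the quantifier and the implications inside `⟺` move to later worlds; composing the
morphisms merges these moves into one. -/
theorem forces_setOf {w : M.W} {e : ℕ → M.D w} {y : ℕ} {φ : Fml} :
    M.Forces w e (all (0 ∊ (y + 1) ⟺ φ)) ↔ ∀ w' (m : M.Hom w w') (d : M.D w'),
      d ε m ▷ e y ↔ M.Forces w' (scons d fun k => m ▷ e k) φ := by
  constructor
  · intro h w' m d
    have := h w' m d
    have h1 := this.1 w' (M.id w')
    have h2 := this.2 w' (M.id w')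
    simp only [map_id] at h1 h2
    exact ⟨h1, h2⟩
  · intro h w' m d
    refine ⟨fun w'' m' h' => ?_, fun w'' m' h' => ?_⟩
    · have := (h w'' (M.comp m m') (m' ▷ d)).1 (by simpa [Forces] using h')
      simpa [map_scons] using this
    · have := (h w'' (M.comp m m') (m' ▷ d)).2 (by simpa [map_scons] using h')
      simpa [Forces] using this

/-- Uncurrying collects premises at a single world, so that a chain of implications costs one change
of world only. -/
theorem forces_imp_imp {w : M.W} {e : ℕ → M.D w} {φ ψ χ : Fml} :
    M.Forces w e (φ ⟹ ψ ⟹ χ) ↔ M.Forces w e (φ ⋏ ψ ⟹ χ) := by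
  constructor
  · intro h w' m h'
    have := h w' m h'.1 w' (M.id w')
    simp only [map_id] at this
    exact this h'.2
  · intro h w' m h1 w'' m' h2
    have := h w'' (M.comp m m')
    simp only [map_comp] at this
    exact this ⟨h1.map m', h2⟩

theorem forces_all_imp_imp {w : M.W} {e : ℕ → M.D w} {φ ψ χ : Fml} :
    M.Forces w e (all (φ ⟹ ψ ⟹ χ)) ↔ M.Forces w e (all (φ ⋏ ψ ⟹ χ)) :=
  forall_congr' fun _ => forall_congr' fun _ => forall_congr' fun _ => forces_imp_imp

theorem forces_all_all_imp_imp {w : M.W} {e : ℕ → M.D w} {φ ψ χ : Fml} :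
    M.Forces w e (all (all (φ ⟹ ψ ⟹ χ))) ↔ M.Forces w e (all (all (φ ⋏ ψ ⟹ χ))) :=
  forall_congr' fun _ => forall_congr' fun _ => forall_congr' fun _ => forces_all_imp_imp

theorem forces_all_all_all_imp_imp {w : M.W} {e : ℕ → M.D w} {φ ψ χ : Fml} :
    M.Forces w e (all (all (all (φ ⟹ ψ ⟹ χ)))) ↔ M.Forces w e (all (all (all (φ ⋏ ψ ⟹ χ)))) :=
  forall_congr' fun _ => forall_congr' fun _ => forall_congr' fun _ => forces_all_all_imp_imp

theorem forces_all_imp {w : M.W} {e : ℕ → M.D w} {φ ψ : Fml} :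
    M.Forces w e (all (φ ⟹ ψ)) ↔ ∀ w' (m : M.Hom w w') (d : M.D w'),
      M.Forces w' (scons d fun k => m ▷ e k) φ → M.Forces w' (scons d fun k => m ▷ e k) ψ := by
  constructor
  · intro h w' m d h'
    have := h w' m d w' (M.id w')
    simp only [map_id] at this
    exact this h'
  · intro h w' m d w'' m' h'
    have := h w'' (M.comp m m') (m' ▷ d)
    simp only [map_comp] at this
    simp only [map_scons] at h' ⊢
    exact this h'

theorem forces_all_all_imp {w : M.W} {e : ℕ → M.D w} {φ ψ : Fml} :
    M.Forces w e (all (all (φ ⟹ ψ))) ↔ ∀ w' (m : M.Hom w w') (c d : M.D w'),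
      M.Forces w' (scons d (scons c fun k => m ▷ e k)) φ →
        M.Forces w' (scons d (scons c fun k => m ▷ e k)) ψ := by
  constructor
  · intro h w' m c d h'
    have := forces_all_imp.1 (h w' m c) w' (M.id w') d
    simp only [map_id] at this
    exact this h'
  · intro h w' m c
    refine forces_all_imp.2 fun w'' m' d h' => ?_
    have := h w'' (M.comp m m') (m' ▷ c) d
    simp only [map_comp] at this
    simp only [map_scons] at h' ⊢
    exact this h'

theorem forces_all_all_all_imp {w : M.W} {e : ℕ → M.D w} {φ ψ : Fml} :
    M.Forces w e (all (all (all (φ ⟹ ψ)))) ↔ ∀ w' (m : M.Hom w w') (b c d : M.D w'),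
      M.Forces w' (scons d (scons c (scons b fun k => m ▷ e k))) φ →
        M.Forces w' (scons d (scons c (scons b fun k => m ▷ e k))) ψ := by
  constructor
  · intro h w' m b c d h'
    have := forces_all_all_imp.1 (h w' m b) w' (M.id w') c d
    simp only [map_id] at this
    exact this h'
  · intro h w' m b
    refine forces_all_all_imp.2 fun w'' m' c d h' => ?_
    have := h w'' (M.comp m m') (m' ▷ b) c d
    simp only [map_comp] at this
    simp only [map_scons] at h' ⊢
    exact this h'

theorem forces_neg {w : M.W} {e : ℕ → M.D w} {φ : Fml} :
    M.Forces w e (∼φ) ↔ ∀ w' (m : M.Hom w w'), ¬ M.Forces w' (fun k => m ▷ e k) φ := Iff.rfl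

theorem forces_and {w : M.W} {e : ℕ → M.D w} {φ ψ : Fml} :
    M.Forces w e (φ ⋏ ψ) ↔ M.Forces w e φ ∧ M.Forces w e ψ := Iff.rfl

theorem forces_or {w : M.W} {e : ℕ → M.D w} {φ ψ : Fml} :
    M.Forces w e (φ ⋎ ψ) ↔ M.Forces w e φ ∨ M.Forces w e ψ := Iff.rfl

theorem forces_ex {w : M.W} {e : ℕ → M.D w} {φ : Fml} :
    M.Forces w e (ex φ) ↔ ∃ d, M.Forces w (scons d e) φ := Iff.rfl

theorem forces_mem {w : M.W} {e : ℕ → M.D w} {x y : ℕ} :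
    M.Forces w e (x ∊ y) ↔ e x ε e y := Iff.rfl

theorem forces_eq {w : M.W} {e : ℕ → M.D w} {x y : ℕ} :
    M.Forces w e (x ≐ y) ↔ e x = e y := Iff.rfl

end KModel

/-- A Kripke model of INF. -/
class INFModel (M : KModel) : Prop where
  ext : ∀ {w : M.W} {x y : M.D w},
    (∀ w' (m : M.Hom w w') (d : M.D w'), d ε m ▷ x ↔ d ε m ▷ y) → x = y
  compr : ∀ φ, Stratified φ → ∀ (w : M.W) (e : ℕ → M.D w), ∃ y : M.D w,
    ∀ w' (m : M.Hom w w') (d : M.D w'), d ε m ▷ y ↔ M.Forces w' (scons d fun k => m ▷ e k) φ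

open KModel

theorem infModel_of_forces {M : KModel} (h : ∀ ψ ∈ theory, ∀ w e, M.Forces w e ψ) : INFModel M where
  ext := by
    intro w x y hxy
    have h1 := h extensionality (Or.inl rfl) w (fun _ => x)
    have h2 := forces_all_all_imp.1 h1 w (M.id w) x y
    simp only [map_id] at h2
    refine h2 (forces_setOf.2 ?_)
    intro w' m d
    exact hxy w' m d
  compr := by
    intro φ hφ w e
    obtain ⟨y, hy⟩ := h (comprehension φ) (Or.inr ⟨φ, hφ, rfl⟩) w e
    refine ⟨y, fun w' m d => ?_⟩
    refine (forces_setOf.1 hy w' m d).trans ?_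
    rw [forces_rename]
    have : (fun k => scons d (fun k => m ▷ scons y e k) (lift Nat.succ k)) =
        scons d (fun k => m ▷ e k) := by
      funext k; cases k <;> rfl
    rw [this]

/-! ### Sets and Church numbers inside a Kripke model of INF -/

section Model

variable {M : KModel} [INFModel M] {w w' : M.W}

theorem ext_iff {x y : M.D w} :
    x = y ↔ ∀ w' (m : M.Hom w w') (d : M.D w'), d ε m ▷ x ↔ d ε m ▷ y :=
  ⟨by rintro rfl; simp, INFModel.ext⟩

/-- The set defined by a stratified formula. -/
noncomputable def cset (φ : Fml) (e : ℕ → M.D w) : M.D w :=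
  @Classical.epsilon _ ⟨e 0⟩ fun y => ∀ w' (m : M.Hom w w') (d : M.D w'),
    d ε m ▷ y ↔ M.Forces w' (scons d fun k => m ▷ e k) φ

theorem mem_map_cset {φ : Fml} (hφ : Stratified φ) (e : ℕ → M.D w) (m : M.Hom w w') (d : M.D w') :
    d ε m ▷ cset φ e ↔ M.Forces w' (scons d fun k => m ▷ e k) φ :=
  Classical.epsilon_spec (INFModel.compr φ hφ w e) w' m d

theorem mem_cset {φ : Fml} (hφ : Stratified φ) (e : ℕ → M.D w) (d : M.D w) :
    d ε cset φ e ↔ M.Forces w (scons d e) φ := by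
  simpa using mem_map_cset hφ e (M.id w) d

/-- The set is chosen separately at each world, but extensionality makes it unique, so the choices
agree along morphisms. -/
theorem map_cset {φ : Fml} (hφ : Stratified φ) (e : ℕ → M.D w) (m : M.Hom w w') :
    m ▷ cset φ e = cset φ (fun k => m ▷ e k) := by
  refine ext_iff.2 fun w'' m' d => ?_
  rw [← M.map_comp, mem_map_cset hφ, mem_map_cset hφ]
  simp

/-! ### Pairs and functions -/

theorem stratified_sing : Stratified (0 ≐ 1) := ⟨fun _ => 0, rfl⟩

theorem stratified_upair : Stratified (0 ≐ 1 ⋎ 0 ≐ 2) := ⟨fun _ => 0, rfl, rfl⟩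

/-- `{x}` -/
noncomputable def sing (x : M.D w) : M.D w := cset (0 ≐ 1) fun _ => x

/-- `{x, y}` -/
noncomputable def upair (x y : M.D w) : M.D w := cset (0 ≐ 1 ⋎ 0 ≐ 2) (scons x fun _ => y)

/-- `⟨x, y⟩` -/
noncomputable def pair (x y : M.D w) : M.D w := upair (sing x) (upair x y)

@[simp] theorem mem_sing {d x : M.D w} : d ε sing x ↔ d = x := mem_cset stratified_sing _ _

@[simp] theorem mem_upair {d x y : M.D w} : d ε upair x y ↔ d = x ∨ d = y :=
  mem_cset stratified_upair _ _

@[simp] theorem map_sing (m : M.Hom w w') (x : M.D w) : m ▷ sing x = sing (m ▷ x) :=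
  map_cset stratified_sing _ _

@[simp] theorem map_upair (m : M.Hom w w') (x y : M.D w) :
    m ▷ upair x y = upair (m ▷ x) (m ▷ y) := by
  rw [upair, map_cset stratified_upair, map_scons]; rfl

@[simp] theorem map_pair (m : M.Hom w w') (x y : M.D w) :
    m ▷ pair x y = pair (m ▷ x) (m ▷ y) := by
  simp [pair]

variable {e : ℕ → M.D w}

theorem forces_isSingleton {s x : ℕ} :
    M.Forces w e (isSingleton s x) ↔ e s = sing (e x) := by
  rw [isSingleton, forces_setOf, ext_iff]
  simp [Forces]

theorem forces_isUPair {s x y : ℕ} :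
    M.Forces w e (isUPair s x y) ↔ e s = upair (e x) (e y) := by
  rw [isUPair, forces_setOf, ext_iff]
  simp [Forces]

theorem forces_isPair {p x y : ℕ} :
    M.Forces w e (isPair p x y) ↔ e p = pair (e x) (e y) := by
  rw [isPair, forces_setOf, ext_iff]
  simp [Forces, forces_isSingleton, forces_isUPair, pair]

theorem forces_pairIn {x y f : ℕ} :
    M.Forces w e (pairIn x y f) ↔ pair (e x) (e y) ε e f := by
  simp [pairIn, Forces, forces_isPair]

theorem sing_injective {x y : M.D w} (h : sing x = sing y) : x = y := by
  have : x ε sing y := h ▸ mem_sing.2 rfl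
  exact mem_sing.1 this

/-- The Kuratowski argument works within one world, because membership in an unordered pair is a
genuine disjunction there. -/
theorem pair_inj {x y a b : M.D w} : pair x y = pair a b ↔ x = a ∧ y = b := by
  refine ⟨fun h => ?_, by rintro ⟨rfl, rfl⟩; rfl⟩
  have hm : ∀ d, (d = sing x ∨ d = upair x y) ↔ (d = sing a ∨ d = upair a b) := by
    intro d
    rw [← mem_upair, ← mem_upair]
    exact iff_of_eq (congrArg (d ε ·) h)
  have hxa : x = a := by
    rcases (hm (sing x)).1 (Or.inl rfl) with h | h
    · exact sing_injective h
    · have : a ε sing x := h ▸ mem_upair.2 (Or.inl rfl)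
      exact (mem_sing.1 this).symm
  subst hxa
  refine ⟨rfl, ?_⟩
  have hy : y = x ∨ y = b := by
    have hy : y ε upair x y := mem_upair.2 (Or.inr rfl)
    rcases (hm (upair x y)).1 (Or.inr rfl) with h | h
    · rw [h, mem_sing] at hy; exact Or.inl hy
    · rw [h, mem_upair] at hy; exact hy
  have hb : b = x ∨ b = y := by
    have hb : b ε upair x b := mem_upair.2 (Or.inr rfl)
    rcases (hm (upair x b)).2 (Or.inr rfl) with h | h
    · rw [h, mem_sing] at hb; exact Or.inl hb
    · rw [h, mem_upair] at hb; exact hb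
  rcases hy with rfl | rfl
  · rcases hb with rfl | rfl <;> rfl
  · rfl

/-- `⟨x, y, z⟩` -/
noncomputable def triple (x y z : M.D w) : M.D w := pair (pair x y) (sing (sing z))

theorem triple_inj {x y z a b c : M.D w} : triple x y z = triple a b c ↔ x = a ∧ y = b ∧ z = c := by
  simp only [triple, pair_inj, and_assoc]
  refine and_congr_right fun _ => and_congr_right fun _ =>
    ⟨fun h => sing_injective (sing_injective h), by rintro rfl; rfl⟩

@[simp] theorem map_triple (m : M.Hom w w') (x y z : M.D w) :
    m ▷ triple x y z = triple (m ▷ x) (m ▷ y) (m ▷ z) := by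
  simp [triple]

theorem forces_isTriple {t x y z : ℕ} :
    M.Forces w e (isTriple t x y z) ↔ e t = triple (e x) (e y) (e z) := by
  simp [isTriple, Forces, forces_isPair, forces_isSingleton, triple]

theorem forces_tripleIn {x y z A : ℕ} :
    M.Forces w e (tripleIn x y z A) ↔ triple (e x) (e y) (e z) ε e A := by
  simp [tripleIn, Forces, forces_isTriple]

/-- `f` is a function. -/
def Func (f : M.D w) : Prop := ∀ w' (m : M.Hom w w') (x y z : M.D w'),
  pair x y ε m ▷ f → pair x z ε m ▷ f → y = z

theorem forces_isFunc {f : ℕ} : M.Forces w e (isFunc f) ↔ Func (e f) := by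
  rw [isFunc, forces_all_all_all_imp_imp, forces_all_all_all_imp]
  simp only [forces_and, forces_pairIn, forces_eq, and_imp]
  rfl

theorem Func.map {M : KModel} {w w' : M.W} {f : M.D w} (h : Func f) (m : M.Hom w w') : Func (m ▷ f) := by
  intro w'' m' x y z
  rw [← M.map_comp]
  exact h w'' _ x y z

end Model

set_option linter.unusedSectionVars false

section Model

variable {M : KModel} [INFModel M] {w w' : M.W} {e : ℕ → M.D w}

/-! ### Church zero and successor -/

theorem stratified_idd : Stratified (ex (isPair 1 0 0)) :=
  ⟨fun _ => 2, 0, stratifiedBy_isPair.2 (by simp)⟩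

/-- The identity function. -/
noncomputable def idd (w : M.W) : M.D w := cset (ex (isPair 1 0 0)) fun _ => Classical.arbitrary _

theorem mem_map_idd {m : M.Hom w w'} {d : M.D w'} : d ε m ▷ idd w ↔ ∃ x, d = pair x x := by
  simp [idd, mem_map_cset stratified_idd, Forces, forces_isPair]

theorem forces_isId {i : ℕ} : M.Forces w e (isId i) ↔ e i = idd w := by
  rw [isId, forces_setOf, ext_iff]
  simp only [mem_map_idd]
  simp [Forces, forces_isPair]

theorem stratified_zero : Stratified (ex (ex (isId 0 ⋏ isPair 2 1 0))) :=
  ⟨fun _ => 5, 3, 3, stratifiedBy_isId.2 (by simp), stratifiedBy_isPair.2 (by simp)⟩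

/-- The Church number zero. -/
noncomputable def zero (w : M.W) : M.D w :=
  cset (ex (ex (isId 0 ⋏ isPair 2 1 0))) fun _ => Classical.arbitrary _

theorem mem_map_zero {m : M.Hom w w'} {d : M.D w'} :
    d ε m ▷ zero w ↔ ∃ f, d = pair f (idd w') := by
  simp [zero, mem_map_cset stratified_zero, Forces, forces_isPair, forces_isId]

@[simp] theorem map_zero (m : M.Hom w w') : m ▷ zero w = zero w' := by
  refine ext_iff.2 fun w'' m' d => ?_
  rw [← M.map_comp, mem_map_zero, mem_map_zero]

theorem forces_isZero {o : ℕ} : M.Forces w e (isZero o) ↔ e o = zero w := by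
  rw [isZero, forces_setOf, ext_iff]
  simp only [mem_map_zero]
  simp [Forces, forces_isPair, forces_isId]

theorem stratified_iterSucc : Stratified
    (ex (ex (ex (ex (isPair 4 3 2 ⋏ isFunc 1 ⋏ pairIn 5 1 6 ⋏ pairIn 3 0 1 ⋏ pairIn 0 2 5))))) :=
  ⟨cons 2 (cons 3 (cons 6 fun _ => 0)), 0, 0, 3, 0, stratifiedBy_isPair.2 (by simp),
    stratifiedBy_isFunc.2 (by simp), stratifiedBy_pairIn.2 (by simp),
    stratifiedBy_pairIn.2 (by simp), stratifiedBy_pairIn.2 (by simp)⟩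

/-- The composition of `f` with the functions that `z` assigns to `f`. -/
noncomputable def iterSucc (f z : M.D w) : M.D w :=
  cset (ex (ex (ex (ex (isPair 4 3 2 ⋏ isFunc 1 ⋏ pairIn 5 1 6 ⋏ pairIn 3 0 1 ⋏ pairIn 0 2 5)))))
    (scons f fun _ => z)

theorem forces_isIterSucc {p f z : ℕ} :
    M.Forces w e (isIterSucc p f z) ↔ e p = iterSucc (e f) (e z) := by
  rw [isIterSucc, forces_setOf, ext_iff]
  simp [Forces, forces_isPair, forces_isFunc, forces_pairIn, iterSucc,
    mem_map_cset stratified_iterSucc, map_scons]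

theorem stratified_succ : Stratified (ex (ex (isPair 2 1 0 ⋏ isFunc 1 ⋏ isIterSucc 0 1 3))) :=
  ⟨cons 5 fun _ => 6, 3, 3, stratifiedBy_isPair.2 (by simp), stratifiedBy_isFunc.2 (by simp),
    stratifiedBy_isIterSucc.2 (by simp)⟩

/-- The Church successor of `z`. -/
noncomputable def succ (z : M.D w) : M.D w :=
  cset (ex (ex (isPair 2 1 0 ⋏ isFunc 1 ⋏ isIterSucc 0 1 3))) fun _ => z

@[simp] theorem map_succ (m : M.Hom w w') (z : M.D w) : m ▷ succ z = succ (m ▷ z) :=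
  map_cset stratified_succ _ _

theorem mem_succ {d z : M.D w} : d ε succ z ↔ ∃ f, Func f ∧ d = pair f (iterSucc f z) := by
  rw [succ, mem_cset stratified_succ]
  simp only [Forces, forces_isPair, forces_isFunc, forces_isIterSucc, scons_zero, scons_succ]
  constructor
  · rintro ⟨f, p, h, hf, rfl⟩
    exact ⟨f, hf, h⟩
  · rintro ⟨f, hf, h⟩
    exact ⟨f, _, h, hf, rfl⟩

theorem forces_isSucc {v z : ℕ} :
    M.Forces w e (isSucc v z) ↔ Func (e z) ∧ e v = succ (e z) := by
  rw [isSucc, forces_and, forces_isFunc, forces_setOf]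
  refine and_congr_right fun _ => ?_
  rw [ext_iff]
  simp [Forces, forces_isPair, forces_isFunc, forces_isIterSucc, succ, mem_map_cset stratified_succ]

theorem func_zero : Func (zero w) := by
  intro w' m x y z h1 h2
  obtain ⟨f, hf⟩ := mem_map_zero.1 h1
  obtain ⟨g, hg⟩ := mem_map_zero.1 h2
  rw [(pair_inj.1 hf).2, (pair_inj.1 hg).2]

theorem func_succ (z : M.D w) : Func (succ z) := by
  intro w' m x y t h1 h2
  rw [map_succ] at h1 h2
  obtain ⟨f, -, hf⟩ := mem_succ.1 h1
  obtain ⟨g, -, hg⟩ := mem_succ.1 h2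
  obtain ⟨rfl, rfl⟩ := pair_inj.1 hf
  obtain ⟨rfl, rfl⟩ := pair_inj.1 hg
  rfl

/-- Zero is defined at every set, a successor only at functions. The universal set `V` separates
them: it contains both `⟨E, E⟩` and `⟨E, V⟩` for the empty set `E`, so it is not a function. -/
theorem zero_ne_succ (z : M.D w) : zero w ≠ succ z := by
  intro h
  obtain ⟨V, hV⟩ := INFModel.compr (M := M) (0 ≐ 0) ⟨fun _ => 0, rfl⟩ w fun _ => z
  obtain ⟨E, hE⟩ := INFModel.compr (M := M) bot ⟨fun _ => 0, trivial⟩ w fun _ => z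
  have hV' : ∀ d, d ε V := fun d => by simpa [Forces] using hV w (M.id w) d
  have hE' : ∀ d, ¬ d ε E := fun d => by simpa [Forces] using hE w (M.id w) d
  have h1 : pair V (idd w) ε succ z := by
    rw [← h]
    simpa using (mem_map_zero (m := M.id w)).2 ⟨V, rfl⟩
  obtain ⟨f, hf, hf'⟩ := mem_succ.1 h1
  rw [← (pair_inj.1 hf').1] at hf
  have := hf w (M.id w) E E V (by simpa using hV' _) (by simpa using hV' _)
  exact hE' V (this ▸ hV' V)

/-! ### Closure under successor and the set of Church numbers -/

/-- `S a = S b` -/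
def SameSucc (a b : M.D w) : Prop := Func a ∧ Func b ∧ succ a = succ b

/-- `X` is closed under successor. -/
def Closed (X : M.D w) : Prop := ∀ w' (m : M.Hom w w') (u : M.D w'),
  u ε m ▷ X → Func u → succ u ε m ▷ X

theorem Closed.succ_mem {X u : M.D w} (h : Closed X) (hu : u ε X) (hf : Func u) : succ u ε X := by
  simpa using h w (M.id w) u (by simpa using hu) hf

theorem forces_sameSucc {a b : ℕ} : M.Forces w e (sameSucc a b) ↔ SameSucc (e a) (e b) := by
  simp only [sameSucc, Forces, forces_isSucc, scons_zero, scons_succ, SameSucc]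
  exact ⟨fun ⟨d, h1, h2⟩ => ⟨h1.1, h2.1, h1.2.symm.trans h2.2⟩,
    fun ⟨h1, h2, h3⟩ => ⟨_, ⟨h1, rfl⟩, h2, h3⟩⟩

theorem forces_zeroIn {X : ℕ} : M.Forces w e (zeroIn X) ↔ zero w ε e X := by
  simp [zeroIn, Forces, forces_isZero]

/-- `isSucc` requires its argument to be in FUNC, so without `hu` the left side could hold
vacuously. -/
theorem forces_succIn {u X : ℕ} (hu : Func (e u)) :
    M.Forces w e (succIn u X) ↔ succ (e u) ε e X := by
  rw [succIn, forces_all_imp]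
  simp only [forces_isSucc, scons_zero, scons_succ, forces_mem]
  constructor
  · intro h
    have := h w (M.id w) (succ (e u))
    simp only [map_id] at this
    exact this ⟨hu, trivial⟩
  · rintro h w' m d ⟨-, rfl⟩
    simpa using M.mem_map m h

theorem forces_succClosed {X : ℕ} : M.Forces w e (succClosed X) ↔ Closed (e X) := by
  rw [succClosed, forces_all_imp]
  simp only [forces_mem, scons_zero, scons_succ]
  constructor
  · intro h w' m u hu hf
    have := h w' m u hu
    rwa [forces_succIn (by simpa using hf)] at this
  · intro h w' m u hu
    rw [succIn, forces_all_imp]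
    simp only [forces_isSucc, scons_zero, scons_succ, forces_mem]
    rintro w'' m' d ⟨hf, rfl⟩
    have := h w'' (M.comp m m') (m' ▷ u)
    simp only [map_comp] at this
    exact this (M.mem_map m' hu) hf

theorem stratified_nat : Stratified (all (zeroIn 0 ⟹ succClosed 0 ⟹ 1 ∊ 0)) :=
  ⟨fun _ => 6, 7, stratifiedBy_zeroIn.2 (by simp), stratifiedBy_succClosed.2 (by simp), rfl⟩

/-- The set of Church numbers. -/
noncomputable def nat (w : M.W) : M.D w :=
  cset (all (zeroIn 0 ⟹ succClosed 0 ⟹ 1 ∊ 0)) fun _ => Classical.arbitrary _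

theorem mem_map_nat {m : M.Hom w w'} {d : M.D w'} : d ε m ▷ nat w ↔
    ∀ w'' (m' : M.Hom w' w'') (X : M.D w''), zero w'' ε X → Closed X → m' ▷ d ε X := by
  rw [nat, mem_map_cset stratified_nat, forces_all_imp_imp, forces_all_imp]
  simp [forces_and, forces_zeroIn, forces_succClosed, forces_mem]

@[simp] theorem map_nat (m : M.Hom w w') : m ▷ nat w = nat w' := by
  refine ext_iff.2 fun w'' m' d => ?_
  rw [← M.map_comp, mem_map_nat, mem_map_nat]

theorem mem_nat {d : M.D w} : d ε nat w ↔
    ∀ w' (m : M.Hom w w') (X : M.D w'), zero w' ε X → Closed X → m ▷ d ε X := by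
  rw [← mem_map_nat (m := M.id w)]; simp

theorem forces_isChurchNumbers {N : ℕ} : M.Forces w e (isChurchNumbers N) ↔ e N = nat w := by
  rw [isChurchNumbers, forces_setOf, ext_iff]
  simp only [forces_all_imp_imp]
  simp only [forces_all_imp, mem_map_nat]
  simp [forces_and, forces_zeroIn, forces_succClosed, forces_mem]

theorem map_mem_nat (m : M.Hom w w') {x : M.D w} (h : x ε nat w) : m ▷ x ε nat w' := by
  simpa using M.mem_map m h

theorem zero_mem_nat : zero w ε nat w := by
  rw [mem_nat]
  intro w' m X h _
  simpa using h

/-- Induction on Church numbers for an arbitrary set. -/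
theorem nat_subset {X x : M.D w} (h0 : zero w ε X) (hs : Closed X) (hx : x ε nat w) : x ε X := by
  simpa using mem_nat.1 hx w (M.id w) X h0 hs

/-- Church successor has domain FUNC, whereas `succ` is defined for every set. This discharges the
side condition for all Church numbers. -/
theorem func_of_mem_nat {x : M.D w} (hx : x ε nat w) : Func x := by
  have hφ : Stratified (isFunc 0) := ⟨fun _ => 3, stratifiedBy_isFunc.2 le_rfl⟩
  have : x ε cset (isFunc 0) fun _ => x := by
    refine nat_subset ?_ ?_ hx
    · rw [mem_cset hφ, forces_isFunc]
      exact func_zero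
    · intro w' m u _ _
      rw [mem_map_cset hφ, forces_isFunc]
      exact func_succ u
  rwa [mem_cset hφ, forces_isFunc] at this

theorem succ_mem_nat {x : M.D w} (hx : x ε nat w) : succ x ε nat w := by
  rw [mem_nat]
  intro w' m X h0 hs
  have hx' := mem_nat.1 hx w' m X h0 hs
  rw [map_succ]
  exact hs.succ_mem hx' ((func_of_mem_nat hx).map m)

theorem closed_nat : Closed (nat w) := by
  intro w' m u hu _
  rw [map_nat] at hu ⊢
  exact succ_mem_nat hu

theorem stratified_inter : Stratified (0 ∊ 1 ⋏ 0 ∊ 2) := ⟨cons 0 fun _ => 1, rfl, rfl⟩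

/-- `X ∩ Y` -/
noncomputable def inter (X Y : M.D w) : M.D w := cset (0 ∊ 1 ⋏ 0 ∊ 2) (scons X fun _ => Y)

theorem mem_map_inter {m : M.Hom w w'} {X Y : M.D w} {d : M.D w'} :
    d ε m ▷ inter X Y ↔ d ε m ▷ X ∧ d ε m ▷ Y :=
  mem_map_cset stratified_inter _ _ _

theorem mem_inter {X Y d : M.D w} : d ε inter X Y ↔ d ε X ∧ d ε Y :=
  mem_cset stratified_inter _ _

/-- Induction on Church numbers for a stratified formula. -/
theorem nat_induction {φ : Fml} (hφ : Stratified φ) {e : ℕ → M.D w}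
    (h0 : M.Forces w (scons (zero w) e) φ)
    (hs : ∀ w' (m : M.Hom w w') (u : M.D w'), u ε nat w' →
      M.Forces w' (scons u fun k => m ▷ e k) φ → M.Forces w' (scons (succ u) fun k => m ▷ e k) φ)
    {x : M.D w} (hx : x ε nat w) : M.Forces w (scons x e) φ := by
  -- Intersecting with `nat w` lets the induction step assume that `u` is a Church number.
  have : x ε inter (nat w) (cset φ e) := by
    refine nat_subset (mem_inter.2 ⟨zero_mem_nat, (mem_cset hφ _ _).2 h0⟩) ?_ hx
    intro w' m u hu _
    rw [mem_map_inter, mem_map_cset hφ, map_nat] at hu ⊢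
    exact ⟨succ_mem_nat hu.1, hs w' m u hu.1 hu.2⟩
  exact (mem_cset hφ _ _).1 (mem_inter.1 this).2

/-! ### Reachability -/

/-- `v` belongs to every set that contains `u` and is closed under successor. -/
def reach (u v : ℕ) : Fml := all ((u + 1) ∊ 0 ⟹ succClosed 0 ⟹ (v + 1) ∊ 0)

theorem stratifiedBy_reach {σ : ℕ → ℕ} {u v : ℕ} :
    StratifiedBy σ (reach u v) ↔ 6 ≤ σ u ∧ σ v = σ u := by
  simp only [reach, stratifiedBy_succClosed, StratifiedBy, cons_zero, cons_succ]
  exact ⟨fun ⟨t, h⟩ => by omega, fun h => ⟨σ u + 1, by omega⟩⟩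

/-- `v` is obtained from `u` by iterating successor. -/
def Reach (u v : M.D w) : Prop := ∀ w' (m : M.Hom w w') (X : M.D w'),
  m ▷ u ε X → Closed X → m ▷ v ε X

theorem forces_reach {u v : ℕ} : M.Forces w e (reach u v) ↔ Reach (e u) (e v) := by
  rw [reach, forces_all_imp_imp, forces_all_imp]
  simp [forces_and, forces_succClosed, forces_mem, Reach]

theorem Reach.refl (u : M.D w) : Reach u u := fun _ _ _ h _ => h

theorem Reach.map {u v : M.D w} (h : Reach u v) (m : M.Hom w w') : Reach (m ▷ u) (m ▷ v) := by
  intro w'' m' X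
  rw [← M.map_comp, ← M.map_comp]
  exact h w'' _ X

theorem Reach.mem {u v X : M.D w} (h : Reach u v) (hu : u ε X) (hX : Closed X) : v ε X := by
  simpa using h w (M.id w) X (by simpa using hu) hX

theorem Reach.trans {u v x : M.D w} (h : Reach u v) (h' : Reach v x) : Reach u x :=
  fun w' m X hu hX => h' w' m X (h w' m X hu hX) hX

theorem reach_succ {u : M.D w} (hu : Func u) : Reach u (succ u) := by
  intro w' m X h hX
  rw [map_succ]
  exact hX.succ_mem h (hu.map m)

theorem reach_zero {x : M.D w} (hx : x ε nat w) : Reach (zero w) x := by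
  intro w' m X h hX
  rw [map_zero] at h
  exact nat_subset h hX (map_mem_nat m hx)

theorem Reach.mem_nat {u v : M.D w} (h : Reach u v) (hu : u ε nat w) : v ε nat w :=
  h.mem hu closed_nat

/-- Induction along reachability for a stratified formula. -/
theorem Reach.induction {φ : Fml} (hφ : Stratified φ) {e : ℕ → M.D w} {u : M.D w} (hu : u ε nat w)
    (h0 : M.Forces w (scons u e) φ)
    (hs : ∀ w' (m : M.Hom w w') (x : M.D w'), x ε nat w' → Reach (m ▷ u) x →
      M.Forces w' (scons x fun k => m ▷ e k) φ → M.Forces w' (scons (succ x) fun k => m ▷ e k) φ)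
    {x : M.D w} (hx : Reach u x) : M.Forces w (scons x e) φ := by
  have hR : Stratified (reach 1 0) := ⟨fun _ => 6, stratifiedBy_reach.2 (by simp)⟩
  have : x ε inter (inter (nat w) (cset (reach 1 0) fun _ => u)) (cset φ e) := by
    refine hx.mem (mem_inter.2 ⟨mem_inter.2 ⟨hu, ?_⟩, (mem_cset hφ _ _).2 h0⟩) ?_
    · rw [mem_cset hR, forces_reach]
      exact Reach.refl u
    · intro w' m x hx _
      rw [mem_map_inter, mem_map_inter, mem_map_cset hφ, mem_map_cset hR, map_nat, forces_reach]
        at hx ⊢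
      obtain ⟨⟨h1, h2⟩, h3⟩ := hx
      exact ⟨⟨succ_mem_nat h1, h2.trans (reach_succ (func_of_mem_nat h1))⟩, hs w' m x h1 h2 h3⟩
  exact (mem_cset hφ _ _).1 (mem_inter.1 this).2

theorem Reach.eq_or_succ {u v : M.D w} (hu : u ε nat w) (h : Reach u v) :
    v = u ∨ Reach (succ u) v := by
  have hφ : Stratified (0 ≐ 1 ⋎ reach 2 0) := ⟨fun _ => 6, rfl, stratifiedBy_reach.2 (by simp)⟩
  have := h.induction hφ (e := scons u fun _ => succ u) hu (Or.inl rfl) ?_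
  · simpa [forces_or, forces_eq, forces_reach] using this
  · intro w' m x hx _ ih
    simp only [map_scons, forces_or, forces_eq, forces_reach, scons_zero, scons_succ, map_succ]
      at ih ⊢
    right
    rcases ih with rfl | ih
    · exact Reach.refl _
    · exact ih.trans (reach_succ (func_of_mem_nat hx))

theorem Reach.eq_or_eq_succ {u v : M.D w} (hu : u ε nat w) (h : Reach u v) :
    v = u ∨ ∃ x, Reach u x ∧ x ε nat w ∧ v = succ x := by
  have hφ : Stratified (0 ≐ 1 ⋎ ex (reach 2 0 ⋏ isSucc 1 0)) :=
    ⟨fun _ => 6, rfl, 6, stratifiedBy_reach.2 (by simp), stratifiedBy_isSucc.2 (by simp)⟩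
  have := h.induction hφ (e := fun _ => u) hu (Or.inl rfl) ?_
  · simp only [forces_or, forces_eq, forces_ex, forces_and, forces_reach, forces_isSucc, scons_zero,
      scons_succ] at this
    rcases this with h | ⟨x, h1, -, h2⟩
    · exact Or.inl h
    · exact Or.inr ⟨x, h1, h1.mem_nat hu, h2⟩
  · intro w' m x hx hux _
    simp only [forces_or, forces_eq, forces_ex, forces_and, forces_reach, forces_isSucc, scons_zero,
      scons_succ]
    exact Or.inr ⟨x, hux, func_of_mem_nat hx, rfl⟩

/-- Induction on `a`. If `u` reaches `b`, the first step tells whether `b = u`, and then `b` reaches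
`S u`, or `S u` still reaches `b`; no decision of equality is needed. -/
theorem reach_total {a b : M.D w} (ha : a ε nat w) (hb : b ε nat w) : Reach a b ∨ Reach b a := by
  have hφ : Stratified (reach 0 1 ⋎ reach 1 0) :=
    ⟨fun _ => 6, stratifiedBy_reach.2 (by simp), stratifiedBy_reach.2 (by simp)⟩
  have := nat_induction hφ (e := fun _ => b) ?_ ?_ ha
  · simpa [forces_or, forces_reach] using this
  · exact Or.inl (forces_reach.2 (reach_zero hb))
  · intro w' m u hu ih
    simp only [forces_or, forces_reach, scons_zero, scons_succ] at ih ⊢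
    rcases ih with ih | ih
    · rcases ih.eq_or_succ hu with h | h
      · rw [h]; exact Or.inr (reach_succ (func_of_mem_nat hu))
      · exact Or.inl h
    · exact Or.inr (ih.trans (reach_succ (func_of_mem_nat hu)))

/-! ### The stem -/

/-- `S u` is not a double successor. -/
def NotDouble (u : M.D w) : Prop := ∀ w' (m : M.Hom w w') (v : M.D w'),
  v ε nat w' → SameSucc v (m ▷ u) → v = m ▷ u

theorem forces_succNotDouble {u N : ℕ} (hN : e N = nat w) :
    M.Forces w e (succNotDouble u N) ↔ NotDouble (e u) := by
  rw [succNotDouble, forces_all_imp_imp, forces_all_imp]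
  simp [forces_and, forces_mem, forces_sameSucc, forces_eq, hN, NotDouble]

theorem NotDouble.map {u : M.D w} (h : NotDouble u) (m : M.Hom w w') : NotDouble (m ▷ u) := by
  intro w'' m' v
  rw [← M.map_comp]
  exact h w'' _ v

theorem NotDouble.eq {u v : M.D w} (h : NotDouble u) (hu : u ε nat w) (hv : v ε nat w)
    (hs : succ v = succ u) : v = u := by
  simpa using h w (M.id w) v hv (by simpa using ⟨func_of_mem_nat hv, func_of_mem_nat hu, hs⟩)

/-- `X` is closed under the successors of Church numbers that are not double successors. -/
def StemClosed (X : M.D w) : Prop := ∀ w' (m : M.Hom w w') (u : M.D w'),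
  u ε nat w' → u ε m ▷ X → NotDouble u → succ u ε m ▷ X

theorem forces_stemClosed {N X : ℕ} (hN : e N = nat w) :
    M.Forces w e (all (0 ∊ (N + 1) ⟹ 0 ∊ (X + 1) ⟹ succNotDouble 0 (N + 1) ⟹ succIn 0 (X + 1))) ↔
      StemClosed (e X) := by
  rw [forces_all_imp_imp, forces_all_imp_imp, forces_all_imp]
  refine forall_congr' fun w' => forall_congr' fun m => forall_congr' fun u => ?_
  rw [forces_and, forces_and, forces_succNotDouble (by simp [hN])]
  simp only [forces_mem, scons_zero, scons_succ, hN, map_nat, and_imp]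
  refine forall_congr' fun hu => ?_
  rw [forces_succIn (by simpa using func_of_mem_nat hu)]
  rfl

theorem stratified_stem : Stratified (0 ∊ 1 ⋏ all (zeroIn 0 ⟹
    all (0 ∊ 3 ⟹ 0 ∊ 1 ⟹ succNotDouble 0 3 ⟹ succIn 0 1) ⟹ 1 ∊ 0)) :=
  ⟨cons 6 fun _ => 7, rfl, 7, stratifiedBy_zeroIn.2 (by simp), ⟨6, rfl, rfl,
    stratifiedBy_succNotDouble.2 (by simp), stratifiedBy_succIn.2 (by simp)⟩, rfl⟩

/-- The stem. -/
noncomputable def stem (w : M.W) : M.D w := cset (0 ∊ 1 ⋏ all (zeroIn 0 ⟹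
    all (0 ∊ 3 ⟹ 0 ∊ 1 ⟹ succNotDouble 0 3 ⟹ succIn 0 1) ⟹ 1 ∊ 0)) fun _ => nat w

theorem forces_stem_body {N : ℕ} {d : M.D w} (hN : e N = nat w) :
    M.Forces w (scons d e) (0 ∊ (N + 1) ⋏ all (zeroIn 0 ⟹
      all (0 ∊ (N + 3) ⟹ 0 ∊ 1 ⟹ succNotDouble 0 (N + 3) ⟹ succIn 0 1) ⟹ 1 ∊ 0)) ↔
    d ε nat w ∧ ∀ w' (m : M.Hom w w') (X : M.D w'), zero w' ε X → StemClosed X → m ▷ d ε X := by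
  rw [forces_and, forces_mem, scons_zero, scons_succ, hN, forces_all_imp_imp, forces_all_imp]
  refine and_congr_right fun _ => forall_congr' fun w' => forall_congr' fun m =>
    forall_congr' fun X => ?_
  rw [forces_and, forces_zeroIn, forces_stemClosed (N := N + 2) (X := 0) (by simp [hN])]
  simp [forces_mem]

theorem mem_map_stem {m : M.Hom w w'} {d : M.D w'} : d ε m ▷ stem w ↔
    d ε nat w' ∧ ∀ w'' (m' : M.Hom w' w'') (X : M.D w''),
      zero w'' ε X → StemClosed X → m' ▷ d ε X := by
  rw [stem, mem_map_cset stratified_stem]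
  exact forces_stem_body (N := 0) (by simp)

@[simp] theorem map_stem (m : M.Hom w w') : m ▷ stem w = stem w' := by
  refine ext_iff.2 fun w'' m' d => ?_
  rw [← M.map_comp, mem_map_stem, mem_map_stem]

theorem mem_stem {d : M.D w} : d ε stem w ↔
    d ε nat w ∧ ∀ w' (m : M.Hom w w') (X : M.D w'), zero w' ε X → StemClosed X → m ▷ d ε X := by
  rw [← mem_map_stem (m := M.id w)]; simp

theorem forces_isStem {T N : ℕ} (hN : e N = nat w) :
    M.Forces w e (isStem T N) ↔ e T = stem w := by
  rw [isStem, forces_setOf, ext_iff]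
  refine forall_congr' fun w' => forall_congr' fun m => forall_congr' fun d => iff_congr Iff.rfl ?_
  rw [mem_map_stem]
  exact forces_stem_body (by simp [hN])

theorem mem_nat_of_mem_stem {x : M.D w} (h : x ε stem w) : x ε nat w := (mem_stem.1 h).1

theorem zero_mem_stem : zero w ε stem w := by
  refine mem_stem.2 ⟨zero_mem_nat, fun w' m X h _ => ?_⟩
  rwa [map_zero]

theorem succ_mem_stem {u : M.D w} (h : u ε stem w) (hd : NotDouble u) : succ u ε stem w := by
  refine mem_stem.2 ⟨succ_mem_nat (mem_nat_of_mem_stem h), fun w' m X h0 hX => ?_⟩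
  have := hX w' (M.id w') (m ▷ u) (map_mem_nat m (mem_nat_of_mem_stem h))
    (by simpa using (mem_stem.1 h).2 w' m X h0 hX) (hd.map m)
  simpa using this

/-- Induction on the stem for a stratified formula. -/
theorem stem_induction {φ : Fml} (hφ : Stratified φ) {e : ℕ → M.D w}
    (h0 : M.Forces w (scons (zero w) e) φ)
    (hs : ∀ w' (m : M.Hom w w') (u : M.D w'), u ε stem w' → NotDouble u →
      M.Forces w' (scons u fun k => m ▷ e k) φ → M.Forces w' (scons (succ u) fun k => m ▷ e k) φ)
    {x : M.D w} (hx : x ε stem w) : M.Forces w (scons x e) φ := by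
  have : x ε inter (stem w) (cset φ e) := by
    have := (mem_stem.1 hx).2 w (M.id w) (inter (stem w) (cset φ e))
      (mem_inter.2 ⟨zero_mem_stem, (mem_cset hφ _ _).2 h0⟩) ?_
    · simpa using this
    · intro w' m u _ hu hd
      rw [mem_map_inter, mem_map_cset hφ, map_stem] at hu ⊢
      exact ⟨succ_mem_stem hu.1 hd, hs w' m u hu.1 hd hu.2⟩
  exact (mem_cset hφ _ _).1 (mem_inter.1 this).2

/-- By stem induction every stem number is zero or `S u` with `S u` not a double successor; in the
second case `S j = S u` forces `j = u`. -/
theorem notDouble_of_succ_mem_stem {j : M.D w} (hj : j ε nat w) (h : succ j ε stem w) :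
    NotDouble j := by
  have hφ : Stratified (0 ≐ 1 ⋎ ex (0 ∊ 3 ⋏ succNotDouble 0 3 ⋏ isSucc 1 0)) :=
    ⟨cons 6 (cons 6 fun _ => 7), rfl, 6, rfl, stratifiedBy_succNotDouble.2 (by simp),
      stratifiedBy_isSucc.2 (by simp)⟩
  have := stem_induction hφ (e := scons (zero w) fun _ => nat w) (Or.inl rfl) ?_ h
  · rw [forces_or, forces_ex] at this
    rcases this with h | ⟨u, hu, hd, hs⟩
    · exact (zero_ne_succ j h.symm).elim
    · rw [forces_succNotDouble (by simp)] at hd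
      rw [forces_isSucc] at hs
      have hu' : u ε nat w := hu
      have hd' : NotDouble u := hd
      have : j = u := hd'.eq hu' hj hs.2
      exact this ▸ hd'
  · intro w' m u hu hd _
    rw [forces_or, forces_ex]
    refine Or.inr ⟨u, ?_, ?_, ?_⟩
    · simpa [forces_mem, map_scons] using mem_nat_of_mem_stem hu
    · rw [forces_succNotDouble (by simp [map_scons])]
      exact hd
    · rw [forces_isSucc]
      exact ⟨func_of_mem_nat (mem_nat_of_mem_stem hu), rfl⟩

/-- The stem is closed under predecessors. -/
theorem mem_stem_of_reach {x y : M.D w} (hx : x ε stem w) (hy : y ε nat w) (h : Reach y x) :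
    y ε stem w := by
  have hφ : Stratified (all (0 ∊ 2 ⟹ reach 0 1 ⟹ 0 ∊ 3)) :=
    ⟨cons 6 fun _ => 7, 6, rfl, stratifiedBy_reach.2 (by simp), rfl⟩
  have := stem_induction hφ (e := scons (nat w) fun _ => stem w) ?_ ?_ hx
  · rw [forces_all_imp_imp, forces_all_imp] at this
    simpa [forces_mem, map_scons] using this w (M.id w) y
      ⟨by simpa [forces_mem, map_scons] using hy, forces_reach.2 (by simpa using h)⟩
  · rw [forces_all_imp_imp, forces_all_imp]
    simp only [forces_and, forces_mem, forces_reach, map_scons, scons_zero, scons_succ, map_nat,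
      map_stem, map_zero]
    rintro w' m y ⟨hy, h⟩
    rcases h.eq_or_eq_succ hy with h | ⟨v, -, -, h⟩
    · exact h ▸ zero_mem_stem
    · exact (zero_ne_succ v h).elim
  · intro w' m u hu hd
    rw [forces_all_imp_imp, forces_all_imp, forces_all_imp_imp, forces_all_imp]
    simp only [forces_and, forces_mem, forces_reach, map_scons, scons_zero, scons_succ, map_nat,
      map_stem, map_succ]
    rintro ih w'' m' y ⟨hy, h⟩
    have hu' : m' ▷ u ε stem w'' := by simpa using M.mem_map m' hu
    -- The last step towards `S u` leaves some `v` with `S v = S u`; since `S u` is not double, `v`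
    -- is `u` and the induction hypothesis applies to `y`.
    rcases h.eq_or_eq_succ hy with h | ⟨v, h1, hv, h⟩
    · exact h ▸ succ_mem_stem hu' (hd.map m')
    · refine ih w'' m' y ⟨hy, ?_⟩
      rwa [← (hd.map m').eq (mem_nat_of_mem_stem hu') hv h.symm]

/-- Stem induction by walking back: if `S (S u)` reaches `S u`, the last step starts at `u`, because
`S u` is not double, and so `S u` already reaches `u`. For `x` zero, zero would be a successor. -/
theorem not_reach_succ_of_mem_stem {x : M.D w} (hx : x ε stem w) : ¬ Reach (succ x) x := by
  have hφ : Stratified (∼(ex (isSucc 0 1 ⋏ reach 0 1))) :=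
    ⟨fun _ => 6, ⟨6, stratifiedBy_isSucc.2 (by simp), stratifiedBy_reach.2 (by simp)⟩, trivial⟩
  have := stem_induction hφ (e := fun _ => x) ?_ ?_ hx
  · intro h
    refine this w (M.id w) ⟨succ x, ?_, ?_⟩
    · rw [forces_isSucc]
      simpa using func_of_mem_nat (mem_nat_of_mem_stem hx)
    · rw [forces_reach]
      simpa using h
  · rintro w' m ⟨d, h1, h2⟩
    simp only [forces_isSucc, forces_reach, map_scons, scons_zero, scons_succ, map_zero] at h1 h2
    obtain ⟨-, rfl⟩ := h1
    rcases h2.eq_or_eq_succ (succ_mem_nat zero_mem_nat) with h | ⟨v, -, -, h⟩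
    · exact zero_ne_succ _ h
    · exact zero_ne_succ _ h
  · rintro w' m u hu hd ih w'' m' ⟨d, h1, h2⟩
    simp only [forces_isSucc, forces_reach, map_scons, scons_zero, scons_succ, map_succ] at h1 h2
    obtain ⟨-, rfl⟩ := h1
    have hu' : m' ▷ u ε stem w'' := by simpa using M.mem_map m' hu
    have hn := mem_nat_of_mem_stem hu'
    have key : Reach (succ (m' ▷ u)) (m' ▷ u) := by
      rcases h2.eq_or_eq_succ (succ_mem_nat (succ_mem_nat hn)) with h | ⟨v, h3, hv, h⟩
      · have := (hd.map m').eq hn (succ_mem_nat hn) h.symm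
        rw [this]
        exact Reach.refl _
      · have := (hd.map m').eq hn hv h.symm
        rw [this] at h3
        exact (reach_succ (func_succ _)).trans h3
    refine ih w'' m' ⟨succ (m' ▷ u), ?_, ?_⟩
    · rw [forces_isSucc]
      simpa [map_scons] using func_of_mem_nat hn
    · rw [forces_reach]
      simpa [map_scons] using key

/-! ### Two numbers with the same successor -/

section Pair

variable {k n : M.D w}

/-- Induction on `u`. The alternative switches only when `u` is `k`: then `S u = S n`, which `n`
reaches. -/
theorem reach_or_reach (hk : k ε nat w) (hn : n ε nat w) (hs : succ k = succ n) {u : M.D w}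
    (hu : u ε nat w) : Reach u k ∨ Reach n u := by
  have hφ : Stratified (reach 0 1 ⋎ reach 2 0) :=
    ⟨fun _ => 6, stratifiedBy_reach.2 (by simp), stratifiedBy_reach.2 (by simp)⟩
  have := nat_induction hφ (e := scons k fun _ => n) (Or.inl (forces_reach.2 (reach_zero hk))) ?_ hu
  · simpa [forces_or, forces_reach] using this
  · intro w' m u hu
    simp only [forces_or, forces_reach, map_scons, scons_zero, scons_succ]
    rintro (h | h)
    · rcases h.eq_or_succ hu with h | h
      · right
        have h2 := congrArg (M.map m) hs
        rw [map_succ, map_succ, h] at h2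
        rw [h2]
        exact reach_succ ((func_of_mem_nat hn).map m)
      · exact Or.inl h
    · exact Or.inr (h.trans (reach_succ (func_of_mem_nat hu)))

/-- Otherwise `n` would lie in the stem too. Whichever of `k`, `n` reaches the other, the common
successor would then return to the one reached, which is impossible in the stem. -/
theorem not_reach_of_mem_stem (hk : k ε stem w) (hn : n ε nat w) (hs : succ k = succ n)
    (hne : k ≠ n) {x : M.D w} (hx : x ε stem w) : ¬ Reach n x := by
  intro h
  have hn' := mem_stem_of_reach hx hn h
  have hk' := mem_nat_of_mem_stem hk
  rcases reach_total hk' hn with h | h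
  · rcases h.eq_or_succ hk' with h | h
    · exact hne h.symm
    · rw [hs] at h
      exact not_reach_succ_of_mem_stem hn' h
  · rcases h.eq_or_succ hn with h | h
    · exact hne h
    · rw [← hs] at h
      exact not_reach_succ_of_mem_stem hk h

theorem reach_succ_self (hk : k ε stem w) (hn : n ε nat w) (hs : succ k = succ n)
    (hne : k ≠ n) : Reach (succ n) n := by
  have hk' := mem_nat_of_mem_stem hk
  rcases reach_total hk' hn with h | h
  · rcases h.eq_or_succ hk' with h | h
    · exact (hne h.symm).elim
    · rwa [hs] at h
  · exact (not_reach_of_mem_stem hk hn hs hne hk h).elim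

end Pair

/-- Moving `x` one step forward keeps `n` ahead of it, except when `x` is `n`; then `hl` starts
another round. -/
theorem Reach.symm_of_loop {n x : M.D w} (hn : n ε nat w) (hl : Reach (succ n) n)
    (h : Reach n x) : Reach x n := by
  have hφ : Stratified (reach 0 1) := ⟨fun _ => 6, stratifiedBy_reach.2 (by simp)⟩
  have := h.induction hφ (e := fun _ => n) hn (forces_reach.2 (Reach.refl n)) ?_
  · exact forces_reach.1 this
  · intro w' m x hx _ ih
    simp only [forces_reach, scons_zero, scons_succ] at ih ⊢
    rcases ih.eq_or_succ hx with h | h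
    · rw [← h]
      simpa using hl.map m
    · exact h

theorem Reach.succ_reach_self {n x : M.D w} (hn : n ε nat w) (hl : Reach (succ n) n)
    (h : Reach n x) : Reach (succ x) x :=
  (Reach.symm_of_loop hn hl (h.trans (reach_succ (func_of_mem_nat (h.mem_nat hn))))).trans h

/-! ### Finite sets have decidable equality -/

/-- `x ≠ y` -/
def Apart (x y : M.D w) : Prop := ∀ w' (m : M.Hom w w'), m ▷ x ≠ m ▷ y

theorem Apart.ne {x y : M.D w} (h : Apart x y) : x ≠ y := by
  simpa using h w (M.id w)

theorem Apart.symm {x y : M.D w} (h : Apart x y) : Apart y x := fun w' m => (h w' m).symm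

theorem Apart.map {x y : M.D w} (h : Apart x y) (m : M.Hom w w') : Apart (m ▷ x) (m ▷ y) := by
  intro w'' m'
  rw [← M.map_comp, ← M.map_comp]
  exact h w'' _

/-- Distinct elements of a world may become equal later, so forced inequality is `Apart` and not
`≠`. -/
theorem forces_ne {x y : ℕ} : M.Forces w e (∼(x ≐ y)) ↔ Apart (e x) (e y) := Iff.rfl

/-- Equality on `X` is decidable. -/
def DecEq (X : M.D w) : Prop := ∀ w' (m : M.Hom w w') (x y : M.D w'),
  x ε m ▷ X → y ε m ▷ X → x = y ∨ Apart x y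

theorem DecEq.map {X : M.D w} (h : DecEq X) (m : M.Hom w w') : DecEq (m ▷ X) := by
  intro w'' m' x y
  rw [← M.map_comp]
  exact h w'' _ x y

theorem forces_decEq {X : ℕ} :
    M.Forces w e (all (all (1 ∊ (X + 2) ⟹ 0 ∊ (X + 2) ⟹ 1 ≐ 0 ⋎ ∼(1 ≐ 0)))) ↔ DecEq (e X) := by
  rw [forces_all_all_imp_imp, forces_all_all_imp]
  simp only [forces_and, forces_or, forces_ne, forces_mem, forces_eq, scons_zero, scons_succ, DecEq,
    and_imp]

/-- The sets with decidable equality form a legitimate `F` in the definition of finiteness.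
Adjoining `c` preserves the property because `c ∉ u` makes `c` apart from every element of `u`. -/
theorem decEq_of_isFinite {X : ℕ} (h : M.Forces w e (isFinite X)) : DecEq (e X) := by
  have hφ : Stratified (all (all (1 ∊ 2 ⟹ 0 ∊ 2 ⟹ 1 ≐ 0 ⋎ ∼(1 ≐ 0)))) :=
    ⟨fun _ => 1, 0, 0, rfl, rfl, rfl, rfl, trivial⟩
  have hF : ∀ w' (m : M.Hom w w') (d : M.D w'),
      d ε m ▷ cset (all (all (1 ∊ 2 ⟹ 0 ∊ 2 ⟹ 1 ≐ 0 ⋎ ∼(1 ≐ 0)))) e ↔ DecEq d := by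
    intro w' m d
    rw [mem_map_cset hφ]
    exact forces_decEq (X := 0)
  rw [isFinite, forces_all_imp_imp, forces_all_imp] at h
  have := h w (M.id w) (cset (all (all (1 ∊ 2 ⟹ 0 ∊ 2 ⟹ 1 ≐ 0 ⋎ ∼(1 ≐ 0)))) e) ⟨?_, ?_⟩
  · simpa [forces_mem, ← hF w (M.id w)] using this
  · obtain ⟨E, hE⟩ := INFModel.compr (M := M) bot ⟨fun _ => 0, trivial⟩ w e
    have hE' : ∀ w' (m : M.Hom w w') (d : M.D w'), ¬ d ε m ▷ E := fun w' m d => (hE w' m d).1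
    refine ⟨E, ?_, ?_⟩
    · intro w' m d w'' m' h
      have := hE' w'' (M.comp m m') (m' ▷ d)
      rw [map_comp] at this
      exact this h
    · have := (hF w (M.id w) E).2 fun w' m x y hx => (hE' w' m x hx).elim
      simpa [forces_mem] using this
  · rw [forces_all_all_imp_imp, forces_all_all_imp]
    simp only [forces_and, forces_mem, forces_neg, scons_zero, scons_succ, map_id, hF, adjoinIn,
      forces_all_imp, forces_setOf, forces_or, forces_eq]
    rintro w' m u c ⟨hu, hc⟩ w'' m' v hv
    rw [← map_comp, hF]
    intro v' n x y hx hy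
    -- If an element of `u` became equal to `c` at a later world, `c` would belong to `u` there.
    have hc' : ∀ x, x ε n ▷ m' ▷ u → Apart x (n ▷ m' ▷ c) := by
      intro x hx v'' n' h
      have h1 := M.mem_map n' hx
      rw [h] at h1
      refine hc v'' (M.comp m' (M.comp n n')) ?_
      simpa using h1
    have hx' := (hv v' n x).1 hx
    have hy' := (hv v' n y).1 hy
    rcases hx' with hx' | hx' <;> rcases hy' with hy' | hy'
    · have := hu v' (M.comp m' n) x y
      rw [map_comp] at this
      exact this hx' hy'
    · exact Or.inr (by rw [hy']; exact hc' x hx')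
    · exact Or.inr (by rw [hx']; exact (hc' y hy').symm)
    · exact Or.inl (hx'.trans hy'.symm)

/-! ### Successor is injective on loops -/

/-- `X` is closed under the successors of elements different from `a`. -/
def avoidClosed (a X : ℕ) : Fml :=
  all (0 ∊ (X + 1) ⟹ ∼(0 ≐ (a + 1)) ⟹ all (isSucc 0 1 ⟹ 0 ∊ (X + 2)))

/-- `v` is obtained from `u` by iterating successor without applying it to `a`. -/
def reachAvoid (a u v : ℕ) : Fml :=
  all ((u + 1) ∊ 0 ⟹ avoidClosed (a + 1) 0 ⟹ (v + 1) ∊ 0)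

theorem stratifiedBy_avoidClosed {σ : ℕ → ℕ} {a X : ℕ} :
    StratifiedBy σ (avoidClosed a X) ↔ 6 ≤ σ a ∧ σ X = σ a + 1 := by
  simp only [avoidClosed, stratifiedBy_isSucc, stratifiedBy_neg, StratifiedBy, cons_zero, cons_succ]
  exact ⟨fun ⟨t, h1, h2, s, h3⟩ => by omega,
    fun h => ⟨σ a, by omega, by omega, σ a, by omega⟩⟩

theorem stratifiedBy_reachAvoid {σ : ℕ → ℕ} {a u v : ℕ} :
    StratifiedBy σ (reachAvoid a u v) ↔ 6 ≤ σ a ∧ σ u = σ a ∧ σ v = σ a := by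
  simp only [reachAvoid, stratifiedBy_avoidClosed, StratifiedBy, cons_zero, cons_succ]
  exact ⟨fun ⟨t, h⟩ => by omega, fun h => ⟨σ a + 1, by omega⟩⟩

/-- `X` is closed under the successors of elements different from `a`. -/
def AvoidClosed (a X : M.D w) : Prop := ∀ w' (m : M.Hom w w') (u : M.D w'),
  u ε m ▷ X → Apart u (m ▷ a) → Func u → succ u ε m ▷ X

/-- `v` is obtained from `u` by iterating successor without applying it to `a`. -/
def ReachAvoid (a u v : M.D w) : Prop := ∀ w' (m : M.Hom w w') (X : M.D w'),
  m ▷ u ε X → AvoidClosed (m ▷ a) X → m ▷ v ε X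

theorem forces_avoidClosed {a X : ℕ} :
    M.Forces w e (avoidClosed a X) ↔ AvoidClosed (e a) (e X) := by
  rw [avoidClosed, forces_all_imp_imp, forces_all_imp]
  simp only [forces_and, forces_ne, forces_mem, scons_zero, scons_succ, forces_all_imp,
    forces_isSucc, map_scons]
  constructor
  · intro h w' m u hu ha hf
    have := h w' m u ⟨hu, ha⟩ w' (M.id w') (succ u)
    simp only [map_id] at this
    exact this ⟨hf, trivial⟩
  · rintro h w' m u ⟨hu, ha⟩ w'' m' d ⟨hf, rfl⟩
    have := h w'' (M.comp m m') (m' ▷ u)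
    simp only [map_comp] at this
    exact this (M.mem_map m' hu) (ha.map m') hf

theorem forces_reachAvoid {a u v : ℕ} :
    M.Forces w e (reachAvoid a u v) ↔ ReachAvoid (e a) (e u) (e v) := by
  rw [reachAvoid, forces_all_imp_imp, forces_all_imp]
  simp [forces_and, forces_avoidClosed, forces_mem, ReachAvoid]

theorem ReachAvoid.refl (a u : M.D w) : ReachAvoid a u u := fun _ _ _ h _ => h

theorem ReachAvoid.step {a u v : M.D w} (h : ReachAvoid a u v) (hv : Func v) (hva : Apart v a) :
    ReachAvoid a u (succ v) := by
  intro w' m X hu hX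
  have := hX w' (M.id w') (m ▷ v) (by simpa using h w' m X hu hX) (by simpa using hva.map m)
    (hv.map m)
  simpa using this

theorem ReachAvoid.eq_or_succ {a u v : M.D w} (h : ReachAvoid a u v) :
    v = u ∨ ReachAvoid a (succ u) v := by
  have hφ : Stratified (0 ≐ 1 ⋎ reachAvoid 3 2 0) :=
    ⟨fun _ => 6, rfl, stratifiedBy_reachAvoid.2 (by simp)⟩
  have := h w (M.id w) (cset (0 ≐ 1 ⋎ reachAvoid 3 2 0) (scons u (scons (succ u) fun _ => a))) ?_ ?_
  · rw [mem_cset hφ] at this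
    simpa [forces_or, forces_eq, forces_reachAvoid] using this
  · rw [mem_cset hφ]
    exact Or.inl (map_id _ _)
  · intro w' m x hx hxa hf
    rw [mem_map_cset hφ] at hx ⊢
    simp only [map_id] at hxa
    simp only [map_scons, forces_or, forces_eq, forces_reachAvoid, scons_zero, scons_succ, map_succ]
      at hx ⊢
    right
    rcases hx with rfl | hx
    · exact ReachAvoid.refl _ _
    · exact hx.step hf hxa

/-- The singleton of `a` is `AvoidClosed`, since its only element is exempt. -/
theorem ReachAvoid.eq_of_self {a v : M.D w} (h : ReachAvoid a a v) : v = a := by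
  have := h w (M.id w) (sing a) (by simp) ?_
  · simpa using this
  · intro w' m u hu hua _
    rw [map_sing, mem_sing] at hu
    rw [hu, map_id] at hua
    exact (hua.ne rfl).elim

/-- Whenever the walk meets `a`, the part so far is forgotten and the walk restarts at `S a`.
Decidable equality is needed to tell whether `a` has been met. -/
theorem ReachAvoid.of_reach (hdec : DecEq (nat w)) {a x : M.D w} (ha : a ε nat w)
    (h : Reach (succ a) x) : ReachAvoid a (succ a) x := by
  have hφ : Stratified (reachAvoid 1 2 0) := ⟨fun _ => 6, stratifiedBy_reachAvoid.2 (by simp)⟩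
  have := h.induction hφ (e := scons a fun _ => succ a) (succ_mem_nat ha)
    (forces_reachAvoid.2 (ReachAvoid.refl _ _)) ?_
  · exact forces_reachAvoid.1 this
  · intro w' m x hx _ ih
    simp only [map_scons, forces_reachAvoid, scons_zero, scons_succ, map_succ] at ih ⊢
    rcases hdec w' m x (m ▷ a) (by simpa using hx) (M.mem_map m ha) with h | h
    · rw [h]
      exact ReachAvoid.refl _ _
    · exact ih.step (func_of_mem_nat hx) h

/-- Suppose `a` and `b` are apart. The invariant at `x` is that `b` can be reached from `x` without
a step from `a`, and `a` without a step from `b`. It holds at `S a = S b`. It passes from `x` to `S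
x`, since `x = b` would contradict its second half and `x = a` its first. Yet the loop brings `x` to
`a`. -/
theorem eq_of_succ_eq_of_loop (hdec : DecEq (nat w)) {a b : M.D w} (ha : a ε nat w)
    (hb : b ε nat w) (hs : succ a = succ b) (hra : Reach (succ a) a) (hrb : Reach (succ a) b) :
    a = b := by
  rcases hdec w (M.id w) a b (by simpa using ha) (by simpa using hb) with h | hab
  · exact h
  have hφ : Stratified (reachAvoid 1 0 2 ⋏ reachAvoid 2 0 1) :=
    ⟨fun _ => 6, stratifiedBy_reachAvoid.2 (by simp), stratifiedBy_reachAvoid.2 (by simp)⟩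
  have := hra.induction hφ (e := scons a fun _ => b) (succ_mem_nat ha) ?_ ?_
  · exact (hab.ne.symm (forces_reachAvoid.1 this.1).eq_of_self).elim
  · refine ⟨forces_reachAvoid.2 (ReachAvoid.of_reach hdec ha hrb), forces_reachAvoid.2 ?_⟩
    simp only [scons_zero, scons_succ]
    rw [hs]
    exact ReachAvoid.of_reach hdec hb (hs ▸ hra)
  · intro w' m x hx _
    simp only [map_scons, forces_and, forces_reachAvoid, scons_zero, scons_succ]
    rintro ⟨h1, h2⟩
    have hab' := hab.map m
    constructor
    · rcases h1.eq_or_succ with h | h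
      · rw [← h] at h2
        exact (hab'.ne h2.eq_of_self).elim
      · exact h
    · rcases h2.eq_or_succ with h | h
      · rw [← h] at h1
        exact (hab'.ne.symm h1.eq_of_self).elim
      · exact h

theorem eq_of_succ_eq_of_reach (hdec : DecEq (nat w)) {n a b : M.D w} (hn : n ε nat w)
    (hl : Reach (succ n) n) (ha : Reach n a) (hb : Reach n b) (hs : succ a = succ b) : a = b := by
  refine eq_of_succ_eq_of_loop hdec (ha.mem_nat hn) (hb.mem_nat hn) hs (Reach.succ_reach_self hn hl ha) ?_
  rw [hs]
  exact Reach.succ_reach_self hn hl hb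

section Pair

variable {k n : M.D w}

/-- If `j` came strictly before `k`, then `S j` would still reach `k` and so lie in the stem, where
it is no double successor. -/
theorem eq_of_reach_of_succ_eq (hk : k ε stem w) {j l : M.D w} (hj : j ε nat w) (hl : l ε nat w)
    (hjl : l ≠ j) (hs : succ l = succ j) (h : Reach j k) : j = k := by
  rcases h.eq_or_succ hj with h | h
  · exact h.symm
  · have := notDouble_of_succ_mem_stem hj (mem_stem_of_reach hk (succ_mem_nat hj) h)
    exact (hjl (this.eq hj hl hs)).elim

/-- A member of the collision that reaches `k` equals `k`; two members on the loop coincide. So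
exactly one is `k`, and the other, on the loop with successor `S n`, is `n`. -/
theorem eq_pair_of_succ_eq (hdec : DecEq (nat w)) (hk : k ε stem w) (hn : n ε nat w)
    (hs : succ k = succ n) (hne : k ≠ n) {j l : M.D w} (hj : j ε nat w) (hl : l ε nat w)
    (hjl : j ≠ l) (hs' : succ j = succ l) : (j = k ∧ l = n) ∨ (j = n ∧ l = k) := by
  have hk' := mem_nat_of_mem_stem hk
  have hloop := reach_succ_self hk hn hs hne
  rcases reach_or_reach hk' hn hs hj with h | h
  · have hjk := eq_of_reach_of_succ_eq hk hj hl hjl.symm hs'.symm h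
    rcases reach_or_reach hk' hn hs hl with h' | h'
    · have hlk := eq_of_reach_of_succ_eq hk hl hj hjl hs' h'
      exact (hjl (hjk.trans hlk.symm)).elim
    · refine Or.inl ⟨hjk, eq_of_succ_eq_of_reach hdec hn hloop h' (Reach.refl n) ?_⟩
      rw [← hs', hjk, hs]
  · rcases reach_or_reach hk' hn hs hl with h' | h'
    · have hlk := eq_of_reach_of_succ_eq hk hl hj hjl hs' h'
      refine Or.inr ⟨eq_of_succ_eq_of_reach hdec hn hloop h (Reach.refl n) ?_, hlk⟩
      rw [hs', hlk, hs]
    · exact (hjl (eq_of_succ_eq_of_reach hdec hn hloop h h' hs')).elim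

/-- Only `n` itself needs an argument: its predecessor on the loop is the last number on the way
from `S n` back to `n`. -/
theorem exists_succ_eq_of_reach (hn : n ε nat w) (hl : Reach (succ n) n) {x : M.D w}
    (h : Reach n x) : ∃ y, Reach n y ∧ y ε nat w ∧ x = succ y := by
  rcases h.eq_or_eq_succ hn with rfl | h
  · rcases hl.eq_or_eq_succ (succ_mem_nat hn) with h | ⟨y, h1, h2, h3⟩
    · exact ⟨x, Reach.refl x, hn, h⟩
    · exact ⟨y, (reach_succ (func_of_mem_nat hn)).trans h1, h2, h3⟩
  · exact h

end Pair

/-! ### The graph of addition -/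

/-- The condition on `t` that defines the graph of addition. -/
def sumBody (N : ℕ) : Fml := all (
    all (0 ∊ (N + 3) ⟹ ex (isZero 0 ⋏ tripleIn 1 0 1 2)) ⟹
    all (all (all (2 ∊ (N + 5) ⟹ 1 ∊ (N + 5) ⟹ 0 ∊ (N + 5) ⟹ tripleIn 2 1 0 3 ⟹
      all (all (isSucc 1 3 ⟹ isSucc 0 2 ⟹ tripleIn 4 1 0 5))))) ⟹
    1 ∊ 0)

theorem stratified_sumBody (N : ℕ) : Stratified (sumBody N) := by
  -- Numbers get index `6`, so the set `N` gets `7`, triples `10`, and the set `X` of triples `11`.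
  refine ⟨cons 10 fun _ => 7, 11, ⟨6, rfl, 6, stratifiedBy_isZero.2 (by simp),
    stratifiedBy_tripleIn.2 (by simp)⟩, ⟨6, 6, 6, rfl, rfl, rfl, stratifiedBy_tripleIn.2 (by simp),
    6, 6, stratifiedBy_isSucc.2 (by simp), stratifiedBy_isSucc.2 (by simp),
    stratifiedBy_tripleIn.2 (by simp)⟩, rfl⟩

/-- `⟨x, 0, x⟩ ∈ X` for all `x ∈ N`. -/
def SumBase (X : M.D w) : Prop := ∀ w' (m : M.Hom w w') (x : M.D w'),
  x ε nat w' → triple x (zero w') x ε m ▷ X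

/-- `⟨x, n, y⟩ ∈ X` implies `⟨x, S n, S y⟩ ∈ X` for `x, n, y ∈ N`. -/
def SumStep (X : M.D w) : Prop := ∀ w' (m : M.Hom w w') (x n y : M.D w'),
  x ε nat w' → n ε nat w' → y ε nat w' → triple x n y ε m ▷ X → triple x (succ n) (succ y) ε m ▷ X

theorem forces_sumBase {N X : ℕ} (hN : e N = nat w) :
    M.Forces w e (all (0 ∊ (N + 1) ⟹ ex (isZero 0 ⋏ tripleIn 1 0 1 (X + 2)))) ↔ SumBase (e X) := by
  rw [forces_all_imp]
  simp [forces_mem, forces_ex, forces_and, forces_isZero, forces_tripleIn, hN, SumBase]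

theorem forces_sumStep {N X : ℕ} (hN : e N = nat w) :
    M.Forces w e (all (all (all (2 ∊ (N + 3) ⟹ 1 ∊ (N + 3) ⟹ 0 ∊ (N + 3) ⟹ tripleIn 2 1 0 (X + 3) ⟹
      all (all (isSucc 1 3 ⟹ isSucc 0 2 ⟹ tripleIn 4 1 0 (X + 5))))))) ↔ SumStep (e X) := by
  rw [forces_all_all_all_imp_imp, forces_all_all_all_imp_imp, forces_all_all_all_imp_imp,
    forces_all_all_all_imp]
  refine forall_congr' fun w' => forall_congr' fun m => forall_congr' fun x => forall_congr' fun n =>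
    forall_congr' fun y => ?_
  simp only [forces_and, forces_mem, forces_tripleIn, scons_zero, scons_succ, hN, map_nat, and_imp]
  refine forall_congr' fun hx => forall_congr' fun hn => forall_congr' fun hy => imp_congr_right fun _ => ?_
  rw [forces_all_all_imp_imp, forces_all_all_imp]
  simp only [forces_and, forces_isSucc, forces_tripleIn, map_scons, scons_zero, scons_succ]
  constructor
  · intro h
    have := h w' (M.id w') (succ n) (succ y)
    simp only [map_id] at this
    exact this ⟨⟨func_of_mem_nat hn, trivial⟩, func_of_mem_nat hy, trivial⟩
  · rintro h w'' m' c d ⟨⟨-, rfl⟩, -, rfl⟩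
    simpa using M.mem_map m' h

theorem forces_sumBody {N : ℕ} {t : M.D w} (hN : e N = nat w) :
    M.Forces w (scons t e) (sumBody N) ↔
      ∀ w' (m : M.Hom w w') (X : M.D w'), SumBase X → SumStep X → m ▷ t ε X := by
  rw [sumBody, forces_all_imp_imp, forces_all_imp]
  refine forall_congr' fun w' => forall_congr' fun m => forall_congr' fun X => ?_
  rw [forces_and, forces_sumBase (N := N + 2) (X := 0) (by simp [hN]),
    forces_sumStep (N := N + 2) (X := 0) (by simp [hN])]
  simp [forces_mem]

theorem forces_isSum {A N : ℕ} (hN : e N = nat w) : M.Forces w e (isSum A N) ↔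
    ∀ w' (m : M.Hom w w') (t : M.D w'), t ε m ▷ e A ↔
      ∀ w'' (m' : M.Hom w' w'') (X : M.D w''), SumBase X → SumStep X → m' ▷ t ε X := by
  refine forces_setOf.trans ?_
  refine forall_congr' fun w' => forall_congr' fun m => forall_congr' fun d => iff_congr Iff.rfl ?_
  exact forces_sumBody (by simp [hN])

theorem exists_isSum (w : M.W) : ∃ A : M.D w, ∀ w' (m : M.Hom w w') (t : M.D w'), t ε m ▷ A ↔
    ∀ w'' (m' : M.Hom w' w'') (X : M.D w''), SumBase X → SumStep X → m' ▷ t ε X := by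
  obtain ⟨A, hA⟩ := INFModel.compr (sumBody 0) (stratified_sumBody 0) w fun _ => nat w
  exact ⟨A, fun w' m t => (hA w' m t).trans (forces_sumBody (by simp))⟩

/-- If `x ⊕ n = y` then `y` is obtained from `x` by iterating successor. -/
theorem reach_of_sum {x n y : M.D w}
    (h : ∀ w' (m : M.Hom w w') (X : M.D w'), SumBase X → SumStep X → m ▷ triple x n y ε X) :
    Reach x y := by
  have hφ : Stratified (ex (ex (ex (isTriple 3 2 1 0 ⋏ reach 2 0)))) :=
    ⟨fun _ => 10, 6, 6, 6, stratifiedBy_isTriple.2 (by simp), stratifiedBy_reach.2 (by simp)⟩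
  -- The comparison set consists of all triples `⟨a, b, c⟩` with `Reach a c`; it satisfies both
  -- clauses that define addition.
  have key : ∀ w' (m : M.Hom w w') (a b c : M.D w'),
      triple a b c ε m ▷ cset (ex (ex (ex (isTriple 3 2 1 0 ⋏ reach 2 0)))) (fun _ => x) ↔
        Reach a c := by
    intro w' m a b c
    rw [mem_map_cset hφ]
    simp only [forces_ex, forces_and, forces_isTriple, forces_reach, scons_zero, scons_succ,
      triple_inj]
    constructor
    · rintro ⟨_, _, _, ⟨rfl, rfl, rfl⟩, h⟩
      exact h
    · intro h
      exact ⟨a, b, c, ⟨rfl, rfl, rfl⟩, h⟩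
  have := h w (M.id w) (cset (ex (ex (ex (isTriple 3 2 1 0 ⋏ reach 2 0)))) fun _ => x) ?_ ?_
  · have h' := key w (M.id w) x n y
    rw [map_id] at this h'
    exact h'.1 this
  · intro w' m a _
    exact (key w' m a _ a).2 (Reach.refl a)
  · intro w' m a b c _ _ hc hr
    exact (key w' m a _ _).2 (((key w' m a b c).1 hr).trans (reach_succ (func_of_mem_nat hc)))

/-! ### The conclusions -/

/-- Reachability is all that is needed from the order: it excludes `j = n`, `ℓ = k`. -/
theorem forces_less {x y N A : ℕ}
    (hA : ∀ w' (m : M.Hom w w') (t : M.D w'), t ε m ▷ e A ↔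
      ∀ w'' (m' : M.Hom w' w'') (X : M.D w''), SumBase X → SumStep X → m' ▷ t ε X)
    (h : M.Forces w e (less x y N A)) : Reach (e x) (e y) := by
  obtain ⟨n, hn, s, hs, ht⟩ := h
  rw [forces_tripleIn] at ht
  refine reach_of_sum (n := s) ((hA w (M.id w) _).1 ?_)
  simpa using ht

theorem forces_uniqueDoubleSucc {k N : ℕ} (hN : e N = nat w) (hk : Func (e k))
    (h1 : ∃ l, e k ε nat w ∧ l ε nat w ∧ Apart (e k) l ∧ succ (e k) = succ l)
    (h2 : ∀ w' (m : M.Hom w w') (a b : M.D w'), a ε nat w' → b ε nat w' → Apart a b →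
      succ a = succ b → succ a = succ (m ▷ e k)) :
    M.Forces w e (uniqueDoubleSucc k N) := by
  refine ⟨succ (e k), forces_isSucc.2 ⟨hk, rfl⟩, ?_⟩
  intro w' m p
  refine ⟨?_, ?_⟩
  · intro w'' m' h
    simp only [isDoubleSucc, forces_ex, forces_and, forces_mem, forces_ne, forces_isSucc, map_scons,
      scons_zero, scons_succ, hN, map_nat] at h
    obtain ⟨a, b, ha, hb, hab, ⟨-, h3⟩, -, h4⟩ := h
    simp only [forces_eq, map_scons, scons_zero, scons_succ, map_succ]
    rw [h3, h2 w'' (M.comp m m') a b ha hb hab (h3.symm.trans h4), map_comp]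
  · intro w'' m' h
    simp only [forces_eq, map_scons, scons_zero, scons_succ, map_succ] at h
    obtain ⟨l, hk', hl, hkl, hs⟩ := h1
    simp only [isDoubleSucc, forces_ex, forces_and, forces_mem, forces_ne, forces_isSucc, map_scons,
      scons_zero, scons_succ, hN, map_nat]
    have hs' := congrArg (fun x => m' ▷ m ▷ x) hs
    simp only [map_succ] at hs'
    refine ⟨m' ▷ m ▷ e k, m' ▷ m ▷ l, map_mem_nat m' (map_mem_nat m hk'),
      map_mem_nat m' (map_mem_nat m hl), (hkl.map m).map m', ⟨(hk.map m).map m', h⟩,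
      ?_, h.trans hs'⟩
    exact func_of_mem_nat (map_mem_nat m' (map_mem_nat m hl))

theorem stratified_loop : Stratified (reach 1 0) := ⟨fun _ => 6, stratifiedBy_reach.2 (by simp)⟩

/-- The loop at `n`. -/
noncomputable def loop (n : M.D w) : M.D w := cset (reach 1 0) fun _ => n

theorem mem_map_loop {n : M.D w} {m : M.Hom w w'} {x : M.D w'} :
    x ε m ▷ loop n ↔ Reach (m ▷ n) x := by
  rw [loop, mem_map_cset stratified_loop, forces_reach]
  rfl

theorem forces_isLoop {L n : ℕ} (hL : e L = loop (e n)) : M.Forces w e (isLoop L n) := by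
  refine forces_setOf.2 fun w' m d => ?_
  rw [hL, mem_map_loop]
  exact (forces_reach (u := n + 1) (v := 0) (e := scons d fun k => m ▷ e k)).symm

theorem forces_isDisjointUnion {N T L n : ℕ} (hN : e N = nat w) (hT : e T = stem w)
    (hL : e L = loop (e n)) (hn : e n ε nat w)
    (h1 : ∀ w' (m : M.Hom w w') (x : M.D w'), x ε nat w' → x ε stem w' ∨ Reach (m ▷ e n) x)
    (h2 : ∀ w' (m : M.Hom w w') (x : M.D w'), x ε stem w' → ¬ Reach (m ▷ e n) x) :
    M.Forces w e (isDisjointUnion N T L) := by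
  constructor
  · refine forces_setOf.2 fun w' m x => ?_
    simp only [forces_or, forces_mem, scons_zero, scons_succ, hN, hT, hL, map_nat, map_stem,
      mem_map_loop]
    refine ⟨h1 w' m x, ?_⟩
    rintro (h | h)
    · exact mem_nat_of_mem_stem h
    · exact h.mem_nat (map_mem_nat m hn)
  · intro w' m x w'' m' h
    simp only [forces_and, forces_mem, map_scons, scons_zero, scons_succ, hT, hL, map_stem] at h
    rw [← map_comp, mem_map_loop] at h
    exact h2 w'' _ _ h.1 h.2

theorem forces_succBijectiveOn {L n : ℕ} (hL : e L = loop (e n)) (hn : e n ε nat w)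
    (h1 : ∀ w' (m : M.Hom w w'), Reach (succ (m ▷ e n)) (m ▷ e n))
    (hdec : DecEq (nat w)) : M.Forces w e (succBijectiveOn L) := by
  have hdec' : ∀ w' (m : M.Hom w w'), DecEq (nat w') := fun w' m => by simpa using hdec.map m
  refine ⟨forces_all_imp.2 ?_, forces_all_imp.2 ?_, ?_⟩
  · intro w' m x
    simp only [forces_ex, forces_and, forces_mem, forces_isSucc, scons_zero, scons_succ, hL,
      mem_map_loop]
    intro h
    have hf := func_of_mem_nat (h.mem_nat (map_mem_nat m hn))
    exact ⟨succ x, h.trans (reach_succ hf), hf, rfl⟩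
  · intro w' m x
    simp only [forces_ex, forces_and, forces_mem, forces_isSucc, scons_zero, scons_succ, hL,
      mem_map_loop]
    intro h
    obtain ⟨y, hy, hy', hs⟩ := exists_succ_eq_of_reach (map_mem_nat m hn) (h1 w' m) h
    exact ⟨y, hy, func_of_mem_nat hy', hs⟩
  · rw [forces_all_all_imp_imp, forces_all_all_imp_imp, forces_all_all_imp]
    intro w' m a b
    simp only [forces_and, forces_mem, forces_sameSucc, forces_eq, scons_zero, scons_succ, hL,
      mem_map_loop]
    rintro ⟨⟨ha, hb⟩, -, -, hs⟩
    exact eq_of_succ_eq_of_reach (hdec' w' m) (map_mem_nat m hn) (h1 w' m) ha hb hs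

end Model

end INF

open INF KModel in
/-- INF proves: the set `N` of Church numbers, its stem `T` and the graph `Sum` of addition exist,
and if `N` is finite, then for all `k ∈ T` and `n ∈ N` with `k ≠ n` and `S k = S n`, the value `S k`
is the only double successor, `(k, n)` is the only pair `(j, l)` with `j ≠ l`, `S j = S l` and `j < l`,
`{k, n}` is the only `{j, l}` with `j ≠ l` and `S j = S l`, and `N` is the disjoint union of the stem
and the loop at `n`, on which successor is a bijection.
Bound variables: `N = 2`, `T = 1`, `Sum = 0`, then `N = 4`, `T = 3`, `Sum = 2`, `k = 1`, `n = 0`, and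
finally `N = 5`, `T = 4`, `Sum = 3`, `k = 2`, `n = 1`, `L = 0`. -/
theorem mainTheorem9 :
    INF.Proves (.ex (.ex (.ex (
      INF.isChurchNumbers 2 ⋏ INF.isStem 1 2 ⋏ INF.isSum 0 2 ⋏
      (INF.isFinite 2 ⟹
        .all (.all (1 ∊ 3 ⟹ 0 ∊ 4 ⟹ ∼(1 ≐ 0) ⟹ INF.sameSucc 1 0 ⟹
          INF.uniqueDoubleSucc 1 4 ⋏
          INF.onlyOrderedPair 1 0 4 2 ⋏
          INF.onlyPair 1 0 4 ⋏
          .ex (INF.isLoop 0 1 ⋏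
            INF.isDisjointUnion 5 4 0 ⋏
            INF.succBijectiveOn 0)))))))) := by
  refine derives_of_forces renameClosed_theory fun M hM w₀ e₀ => ?_
  have : INFModel M := infModel_of_forces hM
  obtain ⟨A₀, hA₀⟩ := exists_isSum w₀
  have hSum := (forces_isSum (e := scons A₀ (scons (stem w₀) (scons (nat w₀) e₀)))
    (A := 0) (N := 2) rfl).2 hA₀
  refine ⟨nat w₀, stem w₀, A₀, forces_isChurchNumbers.2 rfl, (forces_isStem rfl).2 rfl, hSum, ?_⟩
  intro w₁ m₁ hfin
  have hdec₁ := decEq_of_isFinite hfin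
  have hSum₁ := hSum.map m₁
  rw [forces_all_all_imp_imp, forces_all_all_imp_imp, forces_all_all_imp_imp, forces_all_all_imp]
  intro w m k n h
  have hdec := hdec₁.map m
  have hSum₂ := hSum₁.map m
  simp only [map_map_scons, scons_zero, scons_succ, map_nat, map_stem] at h hdec hSum₂ ⊢
  simp only [forces_and, forces_mem, forces_ne, forces_sameSucc, scons_zero, scons_succ] at h
  obtain ⟨⟨⟨hk, hn⟩, hkn⟩, -, -, hs⟩ := h
  have hk' := mem_nat_of_mem_stem hk
  have hA := (forces_isSum rfl).1 hSum₂
  simp only [scons_zero] at hA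
  generalize m ▷ m₁ ▷ A₀ = A at hA
  clear hSum₂ hSum₁ hSum hA₀ hdec₁ hfin
  have hdec' : ∀ w' (m : M.Hom w w'), DecEq (nat w') := fun w' m => by simpa using hdec.map m
  have hsm : ∀ w' (m : M.Hom w w'), succ (m ▷ k) = succ (m ▷ n) := fun w' m => by
    rw [← map_succ, hs, map_succ]
  have hkm : ∀ w' (m : M.Hom w w'), m ▷ k ε stem w' := fun w' m => by
    simpa using M.mem_map m hk
  have hnm : ∀ w' (m : M.Hom w w'), m ▷ n ε nat w' := fun w' m => map_mem_nat m hn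
  have honly : ∀ w' (m : M.Hom w w') (j l : M.D w'), j ε nat w' → l ε nat w' → Apart j l →
      succ j = succ l → (j = m ▷ k ∧ l = m ▷ n) ∨ (j = m ▷ n ∧ l = m ▷ k) :=
    fun w' m j l hj hl hjl h => eq_pair_of_succ_eq (hdec' w' m) (hkm w' m) (hnm w' m) (hsm w' m)
      (hkn w' m) hj hl hjl.ne h
  refine ⟨?_, ?_, ?_, loop n, ?_, ?_, ?_⟩
  · refine forces_uniqueDoubleSucc rfl (func_of_mem_nat hk') ⟨n, hk', hn, hkn, hs⟩ ?_
    intro w' m a b ha hb hab h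
    -- Whether `a` is `k` or `n`, its successor is `S k`.
    rcases honly w' m a b ha hb hab h with ⟨rfl, -⟩ | ⟨rfl, -⟩
    · rfl
    · exact (hsm w' m).symm
  · rw [onlyOrderedPair, forces_all_all_imp_imp, forces_all_all_imp_imp, forces_all_all_imp_imp,
      forces_all_all_imp_imp, forces_all_all_imp]
    rintro w' m j l ⟨⟨⟨⟨hj, hl⟩, hjl⟩, hless⟩, h⟩
    have hr := forces_less (fun w'' m' t => by
      simpa using hA w'' (M.comp m m') t) hless
    rw [forces_sameSucc] at h
    simp only [forces_mem, forces_ne, forces_and, forces_eq, scons_zero, scons_succ, map_nat]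
      at hj hl hjl hr h ⊢
    rcases honly w' m j l hj hl hjl h.2.2 with h | ⟨rfl, rfl⟩
    · exact h
    -- In the swapped case `n < k` would make `n` reach a stem number.
    · exact (not_reach_of_mem_stem (hkm w' m) (hnm w' m) (hsm w' m) (hkn w' m) (hkm w' m) hr).elim
  · rw [onlyPair, forces_all_all_imp_imp, forces_all_all_imp_imp, forces_all_all_imp_imp,
      forces_all_all_imp]
    rintro w' m j l ⟨⟨⟨hj, hl⟩, hjl⟩, h⟩
    rw [forces_sameSucc] at h
    simp only [forces_mem, forces_ne, forces_and, forces_or, forces_eq, scons_zero, scons_succ,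
      map_nat] at hj hl hjl h ⊢
    exact honly w' m j l hj hl hjl h.2.2
  · exact forces_isLoop rfl
  · refine forces_isDisjointUnion (n := 1) rfl rfl rfl hn ?_ ?_
    · intro w' m x hx
      -- Numbers that reach `k` are in the stem, since the stem is closed under predecessors; the
      -- others are reached from `n`.
      rcases reach_or_reach (mem_nat_of_mem_stem (hkm w' m)) (hnm w' m) (hsm w' m) hx with h | h
      · exact Or.inl (mem_stem_of_reach (hkm w' m) hx h)
      · exact Or.inr h
    · intro w' m x hx
      exact not_reach_of_mem_stem (hkm w' m) (hnm w' m) (hsm w' m) (hkn w' m) hx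
  · exact forces_succBijectiveOn (n := 1) rfl hn
      (fun w' m => reach_succ_self (hkm w' m) (hnm w' m) (hsm w' m) (hkn w' m)) hdec
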